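/- Let $0\le\beta<1$. For $n\ge 1$ consider the mean-field (Curie--Weiss) Ising model on $\{+1,-1\}^n$ with energy $H(\sigma)=-\frac1n\sum_{i<j}\sigma_i\sigma_j$ and Gibbs measure $\rho_n(\sigma)=e^{-\beta H(\sigma)}/Z_{n,\beta}$, where $Z_{n,\beta}=\sum_{\sigma'}e^{-\beta H(\sigma')}$. Its (discrete-time) Glauber dynamics chooses at each step a site $i$ uniformly at random and updates $\sigma_i$ to $\pm1$ with probability $$p_\pm=\frac{e^{\pm\beta S(i)}}{e^{\beta S(i)}+e^{-\beta S(i)}},\qquad S(i)=\frac1n\sum_{j\neq i}\sigma_j .$$ Let $m(\sigma)=\frac12\sum_i\sigma_i$. The magnetization chain is the birth-and-death chain on $\{-\frac n2,-\frac n2+1,\dots,\frac n2\}$ with transition probabilities $$p_k=P_{k,k+1}=\frac{\frac n2-k}{n}\,\frac1{1+e^{-\frac{4\beta}{n}(k+\frac12)}},\qquad q_k=P_{k,k-1}=\frac{\frac n2+k}{n}\,\frac1{1+e^{\frac{4\beta}{n}(k-\frac12)}},\qquad P_{k,k}=1-p_k-q_k,$$ and $\pi_n(k)=\sum_{\sigma:\,m(\sigma)=k}\rho_n(\sigma)$.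 Write $\|\mu-\nu\|=\frac12\sum_x|\mu(x)-\nu(x)|$ for total variation distance. (1) For every $n\ge1$, $\rho_n$ is the unique stationary distribution of the Glauber dynamics, $\pi_n$ is the unique stationary distribution of the magnetization chain, and the magnetization chain is the projection of the Glauber dynamics under $\sigma\mapsto m(\sigma)$: for all $\sigma$ and $k$, the probability that one Glauber step from $\sigma$ leads to magnetization $k$ is $P_{m(\sigma),k}$. (2) If the initial law $\lambda_n^0$ of the Glauber dynamics depends on $\sigma$ only through $m(\sigma)$, and $\mu_n^0$ is its image under $m$, then the laws $\lambda_n^t$ and $\mu_n^t$ of the two chains at time $t$ satisfy $\|\lambda_n^t-\rho_n\|=\|\mu_n^t-\pi_n\|$ for all $t\ge0$. (3) The Glauber dynamics started from the configuration with all spins $+1$, and the magnetization chain started from $\frac n2$, exhibit cutoff at time $a_n=\big\lfloor\frac{n\log n}{2(1-\beta)}\big\rfloor$ with window $b_n=n$: $b_n/a_n\to0$ as $n\to\infty$, and, with $d_n(t)$ the total variation distance to stationarity at time $t$ of either chain, $$\lim_{\theta\to\infty}\liminf_{n\to\infty}d_n(a_n-\theta b_n)=1,\qquad \lim_{\theta\to\infty}\limsup_{n\to\infty}d_n(a_n+\theta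 b_n)=0,$$ where $\theta$ is real, times are rounded down to integers, and negative times are read as $0$. -/

import Mathlib

open scoped Matrix Topology

noncomputable section

namespace MeanFieldIsing

/-! ### Finite Markov chains and cutoff -/

/-- Law after `t` steps of the finite Markov chain with transition matrix `P` and
initial law `μ₀` (laws are row vectors). -/
def evolve {Ω : Type} [Fintype Ω] [DecidableEq Ω] (P : Matrix Ω Ω ℝ) (μ₀ : Ω → ℝ) (t : ℕ) :
    Ω → ℝ :=
  μ₀ ᵥ* P ^ t

/-- Total variation distance of two laws on a finite set. -/
def tvDist {Ω : Type} [Fintype Ω] (μ ν : Ω → ℝ) : ℝ :=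
  (1 / 2) * ∑ x, |μ x - ν x|

/-- `π` is the unique stationary probability distribution of `P`. -/
def IsUniqueStationary {Ω : Type} [Fintype Ω] (P : Matrix Ω Ω ℝ) (π : Ω → ℝ) : Prop :=
  π ∈ stdSimplex ℝ Ω ∧ ∀ ν ∈ stdSimplex ℝ Ω, ν ᵥ* P = ν ↔ ν = π

/-- Cutoff, at cutoff time `a` and with cutoff window `b`, of the family of chains `P n` with
initial laws `μ₀ n` and stationary laws `π n`. The parameter `θ` is real, a time is rounded down
to an integer, and a negative time is read as time `0`. -/
structure ExhibitsCutoff {Ω : ℕ → Type} [∀ n, Fintype (Ω n)] [∀ n, DecidableEq (Ω n)]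
    (P : ∀ n, Matrix (Ω n) (Ω n) ℝ) (μ₀ π : ∀ n, Ω n → ℝ) (a b : ℕ → ℤ) : Prop where
  window : Filter.Tendsto (fun n => (b n : ℝ) / (a n : ℝ)) Filter.atTop (𝓝 0)
  before : Filter.Tendsto
    (fun θ : ℝ => Filter.liminf
      (fun n => tvDist (evolve (P n) (μ₀ n) ⌊(a n : ℝ) - θ * (b n : ℝ)⌋.toNat) (π n))
      Filter.atTop) Filter.atTop (𝓝 1)
  after : Filter.Tendsto
    (fun θ : ℝ => Filter.limsup
      (fun n => tvDist (evolve (P n) (μ₀ n) ⌊(a n : ℝ) + θ * (b n : ℝ)⌋.toNat) (π n))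
      Filter.atTop) Filter.atTop (𝓝 0)

/-! ### The mean-field Ising model and its Glauber dynamics -/

/-- Spin configurations on `n` sites; `ℤˣ` is the two-element set `{1, -1}`. -/
abbrev Config (n : ℕ) : Type := Fin n → ℤˣ

/-- The spin at site `i` as a real number. -/
def spin {n : ℕ} (σ : Config n) (i : Fin n) : ℝ := ((σ i : ℤ) : ℝ)

/-- The energy `H(σ) = -(1/n) ∑_{i<j} σ_i σ_j`. -/
def energy {n : ℕ} (σ : Config n) : ℝ :=
  -(1 / (n : ℝ)) * ∑ i : Fin n, ∑ j ∈ Finset.Ioi i, spin σ i * spin σ j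

/-- The partition function. -/
def partitionFn (n : ℕ) (β : ℝ) : ℝ := ∑ σ : Config n, Real.exp (-β * energy σ)

/-- The Gibbs measure. -/
def gibbs (n : ℕ) (β : ℝ) (σ : Config n) : ℝ := Real.exp (-β * energy σ) / partitionFn n β

/-- The local field `S(i) = (1/n) ∑_{j ≠ i} σ_j`. -/
def localField {n : ℕ} (σ : Config n) (i : Fin n) : ℝ :=
  (1 / (n : ℝ)) * ∑ j ∈ Finset.univ.erase i, spin σ j

/-- Probability that site `i`, once selected, is updated to the value `s`:
`e^{β s S(i)} / (e^{β S(i)} + e^{-β S(i)})`. -/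
def updateProb {n : ℕ} (β : ℝ) (σ : Config n) (i : Fin n) (s : ℤˣ) : ℝ :=
  Real.exp (β * ((s : ℤ) : ℝ) * localField σ i) /
    (Real.exp (β * localField σ i) + Real.exp (-(β * localField σ i)))

/-- Transition matrix of the Glauber dynamics: choose a site uniformly at random and update it. -/
def glauber (n : ℕ) (β : ℝ) : Matrix (Config n) (Config n) ℝ :=
  Matrix.of fun σ τ => (1 / (n : ℝ)) * ∑ i : Fin n, ∑ s : ℤˣ,
    updateProb β σ i s * (if τ = Function.update σ i s then 1 else 0)

/-- The Dirac mass at the configuration with all spins plus. -/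
def allPlus (n : ℕ) : Config n → ℝ := Pi.single 1 1

/-! ### The magnetization chain

The state space `{-n/2, -n/2 + 1, …, n/2}` is indexed by `Fin (n + 1)`: the index is the number of
plus spins, and index `j` stands for the value `j - n/2`. -/

/-- The magnetization `m(σ) = (1/2) ∑_i σ_i`. -/
def magnetization {n : ℕ} (σ : Config n) : ℝ := (1 / 2) * ∑ i, spin σ i

/-- The magnetization value with index `j`. -/
def magValue {n : ℕ} (j : Fin (n + 1)) : ℝ := ((j : ℕ) : ℝ) - (n : ℝ) / 2

/-- The index of the magnetization of `σ`, that is, the number of plus spins. -/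
def magIndex {n : ℕ} (σ : Config n) : Fin (n + 1) :=
  ⟨(Finset.univ.filter fun i => σ i = 1).card,
    Nat.lt_succ_of_le ((Finset.card_le_univ _).trans_eq (Fintype.card_fin n))⟩

theorem magValue_magIndex {n : ℕ} (σ : Config n) : magValue (magIndex σ) = magnetization σ := by
  have h : ∀ i, spin σ i = 2 * (if σ i = 1 then (1 : ℝ) else 0) - 1 := by
    intro i
    rcases Int.units_eq_one_or (σ i) with h | h
    · simp [spin, h]; norm_num
    · simp [spin, h]
  simp only [magValue, magIndex, magnetization, h, Finset.sum_sub_distrib, ← Finset.mul_sum,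
    Finset.sum_boole, Finset.sum_const, Finset.card_univ, Fintype.card_fin, nsmul_eq_mul]
  ring

/-- Rate of the jump from `k` to `k + 1`. -/
def upRate (n : ℕ) (β k : ℝ) : ℝ :=
  (((n : ℝ) / 2 - k) / n) * (1 / (1 + Real.exp (-(4 * β / n) * (k + 1 / 2))))

/-- Rate of the jump from `k` to `k - 1`. -/
def downRate (n : ℕ) (β k : ℝ) : ℝ :=
  (((n : ℝ) / 2 + k) / n) * (1 / (1 + Real.exp ((4 * β / n) * (k - 1 / 2))))

/-- Transition matrix of the magnetization chain, a birth-and-death chain. -/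
def magChain (n : ℕ) (β : ℝ) : Matrix (Fin (n + 1)) (Fin (n + 1)) ℝ :=
  Matrix.of fun i j =>
    if (j : ℕ) = i + 1 then upRate n β (magValue i)
    else if (j : ℕ) + 1 = i then downRate n β (magValue i)
    else if j = i then 1 - upRate n β (magValue i) - downRate n β (magValue i)
    else 0

/-- Image under the magnetization of a law on configurations. -/
def magLaw {n : ℕ} (l : Config n → ℝ) (j : Fin (n + 1)) : ℝ :=
  ∑ σ ∈ Finset.univ.filter (fun σ : Config n => magIndex σ = j), l σ

/-- The Dirac mass at the maximal magnetization `n/2`. -/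
def magTop (n : ℕ) : Fin (n + 1) → ℝ := Pi.single (Fin.last n) 1

/-- The cutoff time `n log n / (2 (1 - β))`, rounded down. -/
def cutoffTime (β : ℝ) (n : ℕ) : ℤ := ⌊(n : ℝ) * Real.log n / (2 * (1 - β))⌋

end MeanFieldIsing

end

/-! The energy is a function of the magnetization, and the conditional law of a spin given the
others depends only on its local field. Hence the Glauber dynamics is reversible for the Gibbs
measure, projects onto the magnetization chain, and preserves laws that are constant on
magnetization classes. Within a class no cancellation occurs, so the two distances to stationarity
agree (`tvDist_glauber_eq`) and cutoff is a question about a birth-and-death chain.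

In that chain the stationary fluctuations have order √n, while the mean decays by a factor of about
1 - ρ per step, with ρ = (1-β)/n. Started from n/2 it reaches the scale √n at time n log n /
(2(1-β)), and θn steps more or less change its ratio to √n by exp(∓(1-β)θ).

Contraction, the place where β < 1 enters: `rates_contract` makes the transition operator shrink
Lipschitz constants by 1 - ρ. Summing the variance produced at each step, an L-Lipschitz function
has variance at most L²/ρ at all times (`bdVar_le`).

Lower bound: the mean positive part of the magnetization must stay of order n(1 - ρ)^t. The drift is
-ρk up to a cubic error, which the test function k - Ak³/n² compensates; its running maximum is a
global sub-eigenfunction (`mul_runningCubic_le`). Chebyshev's inequality then separates the law from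
stationarity (`tvDist_magChain_ge`).

Upper bound: a test function with values in [0, 1] may have gradient 1, and contraction alone would
then lose a factor √n. A reverse Poincaré inequality shows that the last n - 1 steps reduce the
gradient to O(1/√n) away from the top (`exists_gradient_bound`). The earlier s steps contract this
to √n(1 - ρ)^s, and the region near the top is controlled by second moments
(`exists_tvDist_magChain_le`). -/

noncomputable section

namespace MeanFieldIsing

/-! ### Birth-and-death operators -/

/-- The transition operator, on functions, of a birth-and-death chain with birth rates `p` and
death rates `q`. -/
def bdOp (p q : ℕ → ℝ) : Module.End ℝ (ℕ → ℝ) where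
  toFun g j := g j + p j * (g (j + 1) - g j) + q j * (g (j - 1) - g j)
  map_add' g h := by ext j; simp only [Pi.add_apply]; ring
  map_smul' c g := by ext j; simp only [Pi.smul_apply, smul_eq_mul, RingHom.id_apply]; ring

theorem bdOp_apply (p q g : ℕ → ℝ) (j : ℕ) :
    bdOp p q g j = g j + p j * (g (j + 1) - g j) + q j * (g (j - 1) - g j) := rfl

theorem bdOp_pow_succ_apply (p q g : ℕ → ℝ) (t : ℕ) :
    (bdOp p q ^ (t + 1)) g = (bdOp p q ^ t) (bdOp p q g) := by
  rw [pow_succ]; rfl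

theorem bdOp_pow_succ_apply' (p q g : ℕ → ℝ) (t : ℕ) :
    (bdOp p q ^ (t + 1)) g = bdOp p q ((bdOp p q ^ t) g) := by
  rw [pow_succ']; rfl

theorem bdOp_pow_const (p q : ℕ → ℝ) (c : ℝ) (t : ℕ) :
    (bdOp p q ^ t) (fun _ => c) = fun _ => c := by
  induction t with
  | zero => rfl
  | succ t ih =>
    rw [bdOp_pow_succ_apply', ih]
    ext j
    simp [bdOp_apply]

/-- Birth and death rates of a chain on `{0, …, n}`; the condition on edges makes the chain
monotone. -/
structure IsMonotoneRates (n : ℕ) (p q : ℕ → ℝ) : Prop where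
  p_nonneg : ∀ j ≤ n, 0 ≤ p j
  q_nonneg : ∀ j ≤ n, 0 ≤ q j
  p_last : p n = 0
  q_zero : q 0 = 0
  add_le_one : ∀ j ≤ n, p j + q j ≤ 1
  edge_le_one : ∀ j < n, p j + q (j + 1) ≤ 1

/-- The variance of `g` after `t` steps of the chain started from `j`. -/
def bdVar (p q g : ℕ → ℝ) (t j : ℕ) : ℝ :=
  (bdOp p q ^ t) (fun i => g i ^ 2) j - ((bdOp p q ^ t) g j) ^ 2

/-- The three coefficients are nonnegative for monotone rates, and they sum to one minus the
increment of `q - p` across the edge. This is the source of contraction. -/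
theorem bdOp_sub_succ (p q g : ℕ → ℝ) (j : ℕ) :
    bdOp p q g (j + 1) - bdOp p q g j =
      (1 - p j - q (j + 1)) * (g (j + 1) - g j) + p (j + 1) * (g (j + 1 + 1) - g (j + 1)) +
        q j * (g j - g (j - 1)) := by
  simp only [bdOp_apply, Nat.add_sub_cancel]
  ring

/-- Law of total variance, conditioning on the state after `t` steps: the mean conditional variance
of the last step, plus the variance of its conditional mean. -/
theorem bdVar_succ (p q g : ℕ → ℝ) (t j : ℕ) :
    bdVar p q g (t + 1) j =
      (bdOp p q ^ t) (bdVar p q g 1) j + bdVar p q (bdOp p q g) t j := by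
  have : bdVar p q g 1 = bdOp p q (fun i => g i ^ 2) - fun i => (bdOp p q g i) ^ 2 := by
    ext i; simp [bdVar]
  rw [this, map_sub]
  simp [bdVar, bdOp_pow_succ_apply]

section

variable {n : ℕ} {p q : ℕ → ℝ}

namespace IsMonotoneRates

/-! ### Positivity, contraction and variance of monotone birth-and-death chains -/

theorem bdOp_mono (h : IsMonotoneRates n p q) {f g : ℕ → ℝ} (hfg : ∀ j ≤ n, f j ≤ g j) :
    ∀ j ≤ n, bdOp p q f j ≤ bdOp p q g j := by
  intro j hj
  have e : ∀ f : ℕ → ℝ, bdOp p q f j = (1 - (p j + q j)) * f j + p j * f (j + 1) +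
      q j * f (j - 1) := fun f => by rw [bdOp_apply]; ring
  rw [e, e]
  have h1 : p j * f (j + 1) ≤ p j * g (j + 1) := by
    rcases hj.lt_or_eq with h' | rfl
    · exact mul_le_mul_of_nonneg_left (hfg _ h') (h.p_nonneg j hj)
    · simp [h.p_last]
  have h2 := mul_le_mul_of_nonneg_left (hfg (j - 1) (by omega)) (h.q_nonneg j hj)
  have h3 := mul_le_mul_of_nonneg_left (hfg j hj) (sub_nonneg.2 (h.add_le_one j hj))
  linarith

theorem bdOp_pow_mono (h : IsMonotoneRates n p q) {f g : ℕ → ℝ} (hfg : ∀ j ≤ n, f j ≤ g j)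
    (t : ℕ) : ∀ j ≤ n, (bdOp p q ^ t) f j ≤ (bdOp p q ^ t) g j := by
  induction t with
  | zero => exact hfg
  | succ t ih =>
    rw [bdOp_pow_succ_apply', bdOp_pow_succ_apply']
    exact h.bdOp_mono ih

theorem bdOp_pow_le_const (h : IsMonotoneRates n p q) {g : ℕ → ℝ} {c : ℝ}
    (hg : ∀ j ≤ n, g j ≤ c) (t : ℕ) : ∀ j ≤ n, (bdOp p q ^ t) g j ≤ c := by
  intro j hj
  have := h.bdOp_pow_mono hg t j hj
  rwa [bdOp_pow_const] at this

theorem const_le_bdOp_pow (h : IsMonotoneRates n p q) {g : ℕ → ℝ} {c : ℝ}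
    (hg : ∀ j ≤ n, c ≤ g j) (t : ℕ) : ∀ j ≤ n, c ≤ (bdOp p q ^ t) g j := by
  intro j hj
  have := h.bdOp_pow_mono hg t j hj
  rwa [bdOp_pow_const] at this

theorem abs_bdOp_sub_le (h : IsMonotoneRates n p q) {ρ : ℝ}
    (hρ : ∀ j < n, ρ ≤ (p j - p (j + 1)) + (q (j + 1) - q j)) {g : ℕ → ℝ} {L : ℝ} (hL : 0 ≤ L)
    (hg : ∀ j < n, |g (j + 1) - g j| ≤ L) :
    ∀ j < n, |bdOp p q g (j + 1) - bdOp p q g j| ≤ (1 - ρ) * L := by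
  intro j hj
  rw [bdOp_sub_succ]
  have h1 : |p (j + 1) * (g (j + 1 + 1) - g (j + 1))| ≤ p (j + 1) * L := by
    rw [abs_mul, abs_of_nonneg (h.p_nonneg _ hj)]
    rcases (Nat.succ_le_of_lt hj).lt_or_eq with h' | h'
    · exact mul_le_mul_of_nonneg_left (hg _ h') (h.p_nonneg _ hj)
    · have : p (j + 1) = 0 := by
        rw [← Nat.succ_eq_add_one, h', h.p_last]
      simp [this]
  have h2 : |q j * (g j - g (j - 1))| ≤ q j * L := by
    rw [abs_mul, abs_of_nonneg (h.q_nonneg _ hj.le)]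
    rcases j with _ | j
    · simp [h.q_zero]
    · exact mul_le_mul_of_nonneg_left (hg j (by omega)) (h.q_nonneg _ hj.le)
  have h3 : |(1 - p j - q (j + 1)) * (g (j + 1) - g j)| ≤ (1 - p j - q (j + 1)) * L := by
    have : 0 ≤ 1 - p j - q (j + 1) := by linarith [h.edge_le_one j hj]
    rw [abs_mul, abs_of_nonneg this]
    exact mul_le_mul_of_nonneg_left (hg j hj) this
  refine (abs_add_three _ _ _).trans ?_
  have := mul_le_mul_of_nonneg_right (hρ j hj) hL
  nlinarith

theorem abs_bdOp_pow_sub_le (h : IsMonotoneRates n p q) {ρ : ℝ} (hρ1 : ρ ≤ 1)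
    (hρ : ∀ j < n, ρ ≤ (p j - p (j + 1)) + (q (j + 1) - q j)) {g : ℕ → ℝ} {L : ℝ} (hL : 0 ≤ L)
    (hg : ∀ j < n, |g (j + 1) - g j| ≤ L) (t : ℕ) :
    ∀ j < n, |(bdOp p q ^ t) g (j + 1) - (bdOp p q ^ t) g j| ≤ (1 - ρ) ^ t * L := by
  induction t with
  | zero => simpa using hg
  | succ t ih =>
    rw [bdOp_pow_succ_apply', pow_succ', mul_assoc]
    exact h.abs_bdOp_sub_le hρ (mul_nonneg (pow_nonneg (by linarith) _) hL) ih

/-- The variance of a three-point law is the sum over pairs of points of the product of their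
weights times the squared difference. Only the pair "up, stay" is kept. -/
theorem bdVar_one_ge (h : IsMonotoneRates n p q) (g : ℕ → ℝ) {j : ℕ} (hj : j ≤ n) :
    p j * (1 - p j - q j) * (g (j + 1) - g j) ^ 2 ≤ bdVar p q g 1 j := by
  simp only [bdVar, pow_one, bdOp_apply]
  have h1 := mul_nonneg (mul_nonneg (h.p_nonneg j hj) (h.q_nonneg j hj))
    (sq_nonneg (g (j + 1) - g (j - 1)))
  have h2 := mul_nonneg (mul_nonneg (h.q_nonneg j hj) (sub_nonneg.2 (h.add_le_one j hj)))
    (sq_nonneg (g (j - 1) - g j))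
  linarith

theorem bdVar_one_le (h : IsMonotoneRates n p q) {g : ℕ → ℝ} {L : ℝ}
    (hg : ∀ j < n, |g (j + 1) - g j| ≤ L) {j : ℕ} (hj : j ≤ n) :
    bdVar p q g 1 j ≤ L ^ 2 := by
  simp only [bdVar, pow_one, bdOp_apply]
  have h1 : p j * (g (j + 1) - g j) ^ 2 ≤ p j * L ^ 2 := by
    rcases hj.lt_or_eq with h' | rfl
    · exact mul_le_mul_of_nonneg_left (sq_le_sq' (abs_le.1 (hg _ h')).1 (abs_le.1 (hg _ h')).2)
        (h.p_nonneg j hj)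
    · simp [h.p_last]
  have h2 : q j * (g j - g (j - 1)) ^ 2 ≤ q j * L ^ 2 := by
    rcases j with _ | j
    · simp [h.q_zero]
    · have := hg j (by omega)
      exact mul_le_mul_of_nonneg_left (sq_le_sq' (abs_le.1 this).1 (abs_le.1 this).2)
        (h.q_nonneg _ hj)
  have h3 := mul_le_mul_of_nonneg_right (h.add_le_one j hj) (sq_nonneg L)
  have h4 := sq_nonneg (p j * (g (j + 1) - g j) + q j * (g (j - 1) - g j))
  linarith

/-- A Lipschitz function has bounded variance at all times. -/
theorem bdVar_le (h : IsMonotoneRates n p q) {ρ : ℝ} (hρ0 : 0 < ρ) (hρ1 : ρ ≤ 1)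
    (hρ : ∀ j < n, ρ ≤ (p j - p (j + 1)) + (q (j + 1) - q j)) (t : ℕ) :
    ∀ {g : ℕ → ℝ} {L : ℝ}, 0 ≤ L → (∀ j < n, |g (j + 1) - g j| ≤ L) →
    ∀ j ≤ n, bdVar p q g t j ≤ L ^ 2 / ρ := by
  induction t with
  | zero =>
    intro g L hL hg j hj
    simp [bdVar]; positivity
  | succ t ih =>
    intro g L hL hg j hj
    rw [bdVar_succ]
    have h1 := h.bdOp_pow_le_const (fun i hi => h.bdVar_one_le hg hi) t j hj
    have h2 := ih (mul_nonneg (by linarith : 0 ≤ 1 - ρ) hL) (h.abs_bdOp_sub_le hρ hL hg) j hj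
    -- Induction step of the geometric series of the (1-ρ)^(2s), whose sum is at most 1/ρ.
    have h3 : L ^ 2 + ((1 - ρ) * L) ^ 2 / ρ ≤ L ^ 2 / ρ := by
      rw [← sub_nonneg]
      have : L ^ 2 / ρ - (L ^ 2 + ((1 - ρ) * L) ^ 2 / ρ) = L ^ 2 * (1 - ρ) := by
        field_simp; ring
      rw [this]
      exact mul_nonneg (sq_nonneg _) (by linarith)
    linarith

/-- Jensen's inequality: the variance decomposes into nonnegative one-step variances. -/
theorem sq_bdOp_pow_le (h : IsMonotoneRates n p q) (g : ℕ → ℝ) (t : ℕ) :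
    ∀ j ≤ n, ((bdOp p q ^ t) g j) ^ 2 ≤ (bdOp p q ^ t) (fun i => g i ^ 2) j := by
  induction t generalizing g with
  | zero => intro j _; simp
  | succ t ih =>
    intro j hj
    rw [← sub_nonneg]
    change 0 ≤ bdVar p q g (t + 1) j
    rw [bdVar_succ]
    refine add_nonneg (h.const_le_bdOp_pow (fun i hi => ?_) t j hj) (sub_nonneg.2 (ih _ j hj))
    refine le_trans (mul_nonneg (mul_nonneg (h.p_nonneg i hi) ?_) (sq_nonneg _))
      (h.bdVar_one_ge g hi)
    linarith [h.add_le_one i hi]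

/-- The commutation of the weighted gradient `p * |∇ g|` with one step of the chain. -/
theorem gradient_bdOp_le (h : IsMonotoneRates n p q) {K : ℝ} (hK1 : 1 ≤ K)
    (hp : ∀ j < n, p (j + 1) ≤ K * p j)
    (hr : ∀ j < n, 1 - p j - q (j + 1) ≤ K * (1 - p j - q j)) (g : ℕ → ℝ) :
    ∀ j ≤ n, p j * |bdOp p q g (j + 1) - bdOp p q g j| ≤
      K * bdOp p q (fun i => p i * |g (i + 1) - g i|) j := by
  intro j hj
  have hu : ∀ i ≤ n, 0 ≤ p i * |g (i + 1) - g i| := fun i hi =>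
    mul_nonneg (h.p_nonneg i hi) (abs_nonneg _)
  rcases hj.lt_or_eq with hj' | rfl
  swap
  · rw [h.p_last, zero_mul]
    refine mul_nonneg (by linarith) ?_
    simpa using h.const_le_bdOp_pow hu 1 j le_rfl
  have e : bdOp p q (fun i => p i * |g (i + 1) - g i|) j =
      (1 - p j - q j) * (p j * |g (j + 1) - g j|) +
        p j * (p (j + 1) * |g (j + 1 + 1) - g (j + 1)|) +
        q j * (p (j - 1) * |g (j - 1 + 1) - g (j - 1)|) := by
    rw [bdOp_apply]; ring
  -- With the weight `p`, the term from the edge above has exactly the coefficient of the chain. The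
  -- other two terms cost a factor `K`: through `hr` for holding, and through the ratio of
  -- consecutive birth rates for the edge below. At the top the weight vanishes, so there is no
  -- boundary term.
  rw [e, bdOp_sub_succ]
  have hedge : 0 ≤ 1 - p j - q (j + 1) := by linarith [h.edge_le_one j hj']
  have h0 : |(1 - p j - q (j + 1)) * (g (j + 1) - g j) +
      p (j + 1) * (g (j + 1 + 1) - g (j + 1)) + q j * (g j - g (j - 1))| ≤
      (1 - p j - q (j + 1)) * |g (j + 1) - g j| + p (j + 1) * |g (j + 1 + 1) - g (j + 1)| +
        q j * |g j - g (j - 1)| := by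
    refine (abs_add_three _ _ _).trans (le_of_eq ?_)
    rw [abs_mul, abs_mul, abs_mul, abs_of_nonneg hedge, abs_of_nonneg (h.p_nonneg _ hj'),
      abs_of_nonneg (h.q_nonneg j hj)]
  have h1 := mul_le_mul_of_nonneg_left h0 (h.p_nonneg j hj)
  have h2 := mul_le_mul_of_nonneg_right (hr j hj') (hu j hj)
  have h3 := mul_le_mul_of_nonneg_right hK1
    (mul_nonneg (h.p_nonneg j hj) (hu (j + 1) hj'))
  have h4 : p j * (q j * |g j - g (j - 1)|) ≤
      K * (q j * (p (j - 1) * |g (j - 1 + 1) - g (j - 1)|)) := by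
    rcases j with _ | j
    · simp [h.q_zero]
    · simp only [Nat.add_sub_cancel]
      have := mul_le_mul_of_nonneg_right (hp j (by omega))
        (mul_nonneg (h.q_nonneg _ hj) (abs_nonneg (g (j + 1) - g j)))
      linarith
  linarith

theorem gradient_bdOp_pow_le (h : IsMonotoneRates n p q) {K : ℝ} (hK1 : 1 ≤ K)
    (hp : ∀ j < n, p (j + 1) ≤ K * p j)
    (hr : ∀ j < n, 1 - p j - q (j + 1) ≤ K * (1 - p j - q j)) (g : ℕ → ℝ) (t : ℕ) :
    ∀ j ≤ n, p j * |(bdOp p q ^ t) g (j + 1) - (bdOp p q ^ t) g j| ≤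
      K ^ t * (bdOp p q ^ t) (fun i => p i * |g (i + 1) - g i|) j := by
  induction t generalizing g with
  | zero => intro j _; simp
  | succ t ih =>
    intro j hj
    rw [bdOp_pow_succ_apply, bdOp_pow_succ_apply]
    refine (ih (bdOp p q g) j hj).trans ?_
    rw [pow_succ, mul_assoc]
    refine mul_le_mul_of_nonneg_left ?_ (pow_nonneg (by linarith) t)
    have := h.bdOp_pow_mono (h.gradient_bdOp_le hK1 hp hr g) t j hj
    refine this.trans (le_of_eq ?_)
    have e : (fun i => K * bdOp p q (fun i => p i * |g (i + 1) - g i|) i) =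
      K • bdOp p q (fun i => p i * |g (i + 1) - g i|) := rfl
    rw [e, map_smul]; rfl

/-- The reverse Poincaré inequality. -/
theorem gradient_sq_le_bdVar (h : IsMonotoneRates n p q) {K c : ℝ} (hK1 : 1 ≤ K)
    (hp : ∀ j < n, p (j + 1) ≤ K * p j)
    (hr : ∀ j < n, 1 - p j - q (j + 1) ≤ K * (1 - p j - q j)) (hc : 0 ≤ c)
    (hc1 : ∀ j ≤ n, c ≤ 1 - p j - q j) (t : ℕ) : ∀ (g : ℕ → ℝ), ∀ j ≤ n,
    c * (t + 1) * (p j * |(bdOp p q ^ t) g (j + 1) - (bdOp p q ^ t) g j|) ^ 2 ≤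
      (K ^ 2) ^ t * bdVar p q g (t + 1) j := by
  -- Each one-step variance dominates `c` times the squared weighted gradient, and Jensen's
  -- inequality with the commutation bound carries this back to the gradient of the `t`-step
  -- evolution.
  have key : ∀ (g : ℕ → ℝ) (t : ℕ), ∀ j ≤ n,
      c * (p j * |(bdOp p q ^ t) g (j + 1) - (bdOp p q ^ t) g j|) ^ 2 ≤
        (K ^ 2) ^ t * (bdOp p q ^ t) (bdVar p q g 1) j := by
    intro g t j hj
    have h1 : ∀ i ≤ n, c * (p i * |g (i + 1) - g i|) ^ 2 ≤ bdVar p q g 1 i := by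
      intro i hi
      refine le_trans ?_ (h.bdVar_one_ge g hi)
      rw [mul_pow, sq_abs, ← mul_assoc]
      refine mul_le_mul_of_nonneg_right ?_ (sq_nonneg _)
      have hp0 := h.p_nonneg i hi
      have hp1 : p i ≤ 1 := by linarith [h.add_le_one i hi, h.q_nonneg i hi]
      have := mul_le_mul_of_nonneg_left (hc1 i hi) hp0
      nlinarith [mul_nonneg hc hp0, mul_nonneg (mul_nonneg hc hp0) (sub_nonneg.2 hp1)]
    have h2 := h.bdOp_pow_mono h1 t j hj
    have e : (fun i => c * (p i * |g (i + 1) - g i|) ^ 2) =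
      c • (fun i => (p i * |g (i + 1) - g i|) ^ 2) := rfl
    rw [e, map_smul, Pi.smul_apply, smul_eq_mul] at h2
    have h3 := h.sq_bdOp_pow_le (fun i => p i * |g (i + 1) - g i|) t j hj
    have h4 := pow_le_pow_left₀ (mul_nonneg (h.p_nonneg j hj) (abs_nonneg _))
      (h.gradient_bdOp_pow_le hK1 hp hr g t j hj) 2
    have hKt : (0 : ℝ) ≤ (K ^ 2) ^ t := by positivity
    calc _ ≤ c * (K ^ t * (bdOp p q ^ t) (fun i => p i * |g (i + 1) - g i|) j) ^ 2 :=
          mul_le_mul_of_nonneg_left h4 hc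
      _ = (K ^ 2) ^ t * (c * ((bdOp p q ^ t) (fun i => p i * |g (i + 1) - g i|) j) ^ 2) := by
          rw [mul_pow, ← pow_mul, ← pow_mul, mul_comm t 2]; ring
      _ ≤ (K ^ 2) ^ t * (c * (bdOp p q ^ t) (fun i => (p i * |g (i + 1) - g i|) ^ 2) j) :=
          mul_le_mul_of_nonneg_left (mul_le_mul_of_nonneg_left h3 hc) hKt
      _ ≤ _ := mul_le_mul_of_nonneg_left h2 hKt
  induction t with
  | zero =>
    intro g j hj
    simpa using key g 0 j hj
  | succ t ih =>
    intro g j hj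
    -- The variance telescopes into one contribution per step, and all of them are bounded below by
    -- the same gradient. This yields the factor `t + 1`.
    rw [bdVar_succ, mul_add]
    have h1 := key g (t + 1) j hj
    have h2 := ih (bdOp p q g) j hj
    rw [← bdOp_pow_succ_apply] at h2
    have h3 : (K ^ 2) ^ t * bdVar p q (bdOp p q g) (t + 1) j ≤
        (K ^ 2) ^ (t + 1) * bdVar p q (bdOp p q g) (t + 1) j := by
      refine mul_le_mul_of_nonneg_right (pow_le_pow_right₀ (one_le_pow₀ hK1) (by omega)) ?_
      exact sub_nonneg.2 (h.sq_bdOp_pow_le _ _ j hj)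
    push_cast
    linarith

/-- After `t + 1` steps a `[0, 1]`-valued function has gradient of order `1 / √t`. -/
theorem gradient_sq_le (h : IsMonotoneRates n p q) {K c : ℝ} (hK1 : 1 ≤ K)
    (hp : ∀ j < n, p (j + 1) ≤ K * p j)
    (hr : ∀ j < n, 1 - p j - q (j + 1) ≤ K * (1 - p j - q j)) (hc : 0 ≤ c)
    (hc1 : ∀ j ≤ n, c ≤ 1 - p j - q j) (t : ℕ) (g : ℕ → ℝ) (hg0 : ∀ j ≤ n, 0 ≤ g j)
    (hg1 : ∀ j ≤ n, g j ≤ 1) (j : ℕ) (hj : j ≤ n) :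
    c * (t + 1) * (p j * |(bdOp p q ^ t) g (j + 1) - (bdOp p q ^ t) g j|) ^ 2 ≤ (K ^ 2) ^ t := by
  refine (h.gradient_sq_le_bdVar hK1 hp hr hc hc1 t g j hj).trans
    (mul_le_of_le_one_right (by positivity) ?_)
  have := h.bdOp_pow_le_const (c := 1) (g := fun i => g i ^ 2)
    (fun i hi => pow_le_one₀ (hg0 i hi) (hg1 i hi)) (t + 1) j hj
  exact (sub_le_self _ (sq_nonneg _)).trans this

/-- A sub-eigenfunction grows at least geometrically. -/
theorem pow_mul_le_bdOp_pow (h : IsMonotoneRates n p q) {r : ℝ} (hr : 0 ≤ r) {G : ℕ → ℝ}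
    (hG : ∀ j ≤ n, r * G j ≤ bdOp p q G j) (t : ℕ) :
    ∀ j ≤ n, r ^ t * G j ≤ (bdOp p q ^ t) G j := by
  induction t with
  | zero => intro j _; simp
  | succ t ih =>
    intro j hj
    rw [bdOp_pow_succ_apply]
    have h1 := h.bdOp_pow_mono hG t j hj
    have e : (fun i => r * G i) = r • G := rfl
    rw [e, map_smul, Pi.smul_apply, smul_eq_mul] at h1
    refine le_trans ?_ h1
    rw [pow_succ', mul_assoc]
    exact mul_le_mul_of_nonneg_left (ih j hj) hr

/-- Expanding the square, the increment is 2(j-a)(p-q) + (p+q). State 0 is separate because there `j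
- 1` is truncated; its death rate is zero. -/
theorem bdOp_sq_le (h : IsMonotoneRates n p q) {ρ a : ℝ}
    (hd : ∀ j ≤ n, ((j : ℝ) - a) * (p j - q j) ≤ -ρ * ((j : ℝ) - a) ^ 2) :
    ∀ j ≤ n, bdOp p q (fun i => ((i : ℝ) - a) ^ 2) j ≤ (1 - 2 * ρ) * ((j : ℝ) - a) ^ 2 + 1 := by
  intro j hj
  have h1 := hd j hj
  have h2 := h.add_le_one j hj
  rw [bdOp_apply]
  rcases j with _ | j
  · simp only [h.q_zero] at *
    push_cast at *
    nlinarith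
  · simp only [Nat.add_sub_cancel]
    push_cast at *
    nlinarith

theorem bdOp_pow_sq_le (h : IsMonotoneRates n p q) {ρ a : ℝ} (hρ0 : 0 < ρ) (hρ1 : 2 * ρ ≤ 1)
    (hd : ∀ j ≤ n, ((j : ℝ) - a) * (p j - q j) ≤ -ρ * ((j : ℝ) - a) ^ 2) (t : ℕ) :
    ∀ j ≤ n, (bdOp p q ^ t) (fun i => ((i : ℝ) - a) ^ 2) j ≤
      (1 - 2 * ρ) ^ t * ((j : ℝ) - a) ^ 2 + 1 / (2 * ρ) := by
  induction t with
  | zero => intro j _; simp; positivity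
  | succ t ih =>
    intro j hj
    rw [bdOp_pow_succ_apply]
    refine (h.bdOp_pow_mono (h.bdOp_sq_le hd) t j hj).trans ?_
    have e : (fun j : ℕ => (1 - 2 * ρ) * ((j : ℝ) - a) ^ 2 + 1) =
      (1 - 2 * ρ) • (fun j : ℕ => ((j : ℝ) - a) ^ 2) + fun _ => (1 : ℝ) := rfl
    rw [e, map_add, map_smul, bdOp_pow_const]
    simp only [Pi.add_apply, Pi.smul_apply, smul_eq_mul]
    have h2 := mul_le_mul_of_nonneg_left (ih j hj) (by linarith : 0 ≤ 1 - 2 * ρ)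
    -- 1/(2ρ) is the fixed point of v ↦ (1-2ρ)v + 1.
    have h3 : (1 - 2 * ρ) * (1 / (2 * ρ)) + 1 = 1 / (2 * ρ) := by field_simp; ring
    rw [pow_succ']
    linarith

end IsMonotoneRates

end

/-! ### Estimates for the logistic function -/

/-- The derivative σ(1-σ) is at most 1/4. -/
theorem sigmoid_sub_le {x y : ℝ} (hxy : x ≤ y) :
    Real.sigmoid y - Real.sigmoid x ≤ (y - x) / 4 := by
  have hm : Monotone fun u : ℝ => u / 4 - Real.sigmoid u := by
    have hd : ∀ u, HasDerivAt (fun u : ℝ => u / 4 - Real.sigmoid u)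
        (1 / 4 - Real.sigmoid u * (1 - Real.sigmoid u)) u := fun u =>
      ((hasDerivAt_id u).div_const 4).sub (Real.hasDerivAt_sigmoid u)
    refine monotone_of_deriv_nonneg (fun u => (hd u).differentiableAt) fun u => ?_
    rw [(hd u).deriv]
    nlinarith [sq_nonneg (Real.sigmoid u - 1 / 2)]
  have := hm hxy
  simp only at this
  linarith

/-- The derivative is 1/4 - (σ-1/2)², and σ(u) - 1/2 ≤ u/4, so it is at least 1/4 - u²/16;
integration gives the cubic term. -/
theorem le_sigmoid {x : ℝ} (hx : 0 ≤ x) :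
    1 / 2 + x / 4 - x ^ 3 / 48 ≤ Real.sigmoid x := by
  have hd : ∀ u, HasDerivAt (fun u : ℝ => Real.sigmoid u - (1 / 2 + u / 4 - u ^ 3 / 48))
      (Real.sigmoid u * (1 - Real.sigmoid u) - (1 / 4 - 3 * u ^ 2 / 48)) u := fun u => by
    have h1 := ((((hasDerivAt_id u).div_const 4).const_add (1 / 2)).sub
      ((hasDerivAt_pow 3 u).div_const 48))
    have h2 := (Real.hasDerivAt_sigmoid u).sub h1
    refine h2.congr_deriv ?_
    norm_num
  have hm : MonotoneOn (fun u : ℝ => Real.sigmoid u - (1 / 2 + u / 4 - u ^ 3 / 48))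
      (Set.Ici 0) := by
    refine monotoneOn_of_deriv_nonneg (convex_Ici 0)
      (fun u _ => (hd u).continuousAt.continuousWithinAt)
      (fun u _ => (hd u).differentiableAt.differentiableWithinAt) fun u hu => ?_
    rw [interior_Ici] at hu
    rw [(hd u).deriv]
    have h1 := sigmoid_sub_le (le_of_lt hu)
    have h2 := Real.sigmoid_le (le_of_lt hu)
    rw [Real.sigmoid_zero] at h1 h2
    nlinarith
  have := hm (Set.mem_Ici.2 le_rfl) (Set.mem_Ici.2 hx) hx
  simp only [Real.sigmoid_zero] at this
  norm_num at this
  linarith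

/-! ### The rates of the magnetization chain -/

theorem upRate_eq (n : ℕ) (β k : ℝ) :
    upRate n β k = (((n : ℝ) / 2 - k) / n) * Real.sigmoid (4 * β / n * (k + 1 / 2)) := by
  rw [upRate, Real.sigmoid_def, one_div, neg_mul]

theorem downRate_eq (n : ℕ) (β k : ℝ) :
    downRate n β k =
      (((n : ℝ) / 2 + k) / n) * (1 - Real.sigmoid (4 * β / n * (k - 1 / 2))) := by
  rw [downRate, ← Real.sigmoid_neg, Real.sigmoid_def, one_div, neg_neg]

/-- The symmetry of the model under a global spin flip. -/
theorem downRate_eq_upRate_neg (n : ℕ) (β k : ℝ) : downRate n β k = upRate n β (-k) := by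
  rw [downRate_eq, upRate_eq, ← Real.sigmoid_neg]
  congr 2 <;> ring

/-- The birth rate at index `j`. -/
def birthRate (n : ℕ) (β : ℝ) (j : ℕ) : ℝ := upRate n β ((j : ℝ) - (n : ℝ) / 2)

/-- The death rate at index `j`. -/
def deathRate (n : ℕ) (β : ℝ) (j : ℕ) : ℝ := downRate n β ((j : ℝ) - (n : ℝ) / 2)

section Rates

variable {n : ℕ} {β : ℝ}

theorem birthRate_eq (hn : 1 ≤ n) (β : ℝ) (j : ℕ) : birthRate n β j =
    (1 - (j : ℝ) / n) * Real.sigmoid (4 * β / n * ((j : ℝ) - (n : ℝ) / 2 + 1 / 2)) := by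
  have : (n : ℝ) ≠ 0 := by positivity
  rw [birthRate, upRate_eq]
  congr 1
  field_simp; ring

theorem deathRate_eq (n : ℕ) (β : ℝ) (j : ℕ) : deathRate n β j =
    (j : ℝ) / n * (1 - Real.sigmoid (4 * β / n * ((j : ℝ) - (n : ℝ) / 2 - 1 / 2))) := by
  rw [deathRate, downRate_eq]
  congr 1
  ring

/-- The sigmoid has the same argument as in the birth rate at `j`: both jumps along an edge see the
same local field. This drives the cancellations below. -/
theorem deathRate_succ_eq (n : ℕ) (β : ℝ) (j : ℕ) : deathRate n β (j + 1) =
    ((j : ℝ) / n + 1 / n) *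
      (1 - Real.sigmoid (4 * β / n * ((j : ℝ) - (n : ℝ) / 2 + 1 / 2))) := by
  rw [deathRate_eq]
  push_cast
  congr 1
  · ring
  · congr 3; ring

theorem birthRate_succ_eq (hn : 1 ≤ n) (β : ℝ) (j : ℕ) : birthRate n β (j + 1) =
    (1 - (j : ℝ) / n - 1 / n) *
      Real.sigmoid (4 * β / n * ((j : ℝ) - (n : ℝ) / 2 + 3 / 2)) := by
  rw [birthRate_eq hn]
  push_cast
  congr 1
  · ring
  · congr 2; ring

theorem div_le_one_of_index (hn : 1 ≤ n) {j : ℕ} (hj : j ≤ n) :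
    0 ≤ (j : ℝ) / n ∧ (j : ℝ) / n ≤ 1 := by
  have : (0 : ℝ) < n := by positivity
  exact ⟨by positivity, (div_le_one this).2 (by exact_mod_cast hj)⟩

theorem div_add_le_one_of_index (hn : 1 ≤ n) {j : ℕ} (hj : j < n) :
    (j : ℝ) / n + 1 / n ≤ 1 := by
  have : (0 : ℝ) < n := by positivity
  rw [← add_div, div_le_one this]
  exact_mod_cast hj

theorem isMonotoneRates (hn : 1 ≤ n) (β : ℝ) :
    IsMonotoneRates n (birthRate n β) (deathRate n β) where
  p_nonneg j hj := by
    rw [birthRate_eq hn]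
    exact mul_nonneg (by linarith [(div_le_one_of_index hn hj).2]) (Real.sigmoid_nonneg _)
  q_nonneg j hj := by
    rw [deathRate_eq]
    exact mul_nonneg (div_le_one_of_index hn hj).1 (sub_nonneg.2 (Real.sigmoid_le_one _))
  p_last := by
    have : (n : ℝ) ≠ 0 := by positivity
    rw [birthRate_eq hn]; field_simp; ring
  q_zero := by rw [deathRate_eq]; simp
  add_le_one j hj := by
    have h := div_le_one_of_index hn hj
    rw [birthRate_eq hn, deathRate_eq]
    have h1 := mul_le_mul_of_nonneg_left (Real.sigmoid_le_one
      (4 * β / n * ((j : ℝ) - (n : ℝ) / 2 + 1 / 2))) (by linarith [h.2] : 0 ≤ 1 - (j : ℝ) / n)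
    have h2 := mul_nonneg h.1 (Real.sigmoid_nonneg
      (4 * β / n * ((j : ℝ) - (n : ℝ) / 2 - 1 / 2)))
    linarith
  edge_le_one j hj := by
    have h := div_le_one_of_index hn hj.le
    have h' := div_add_le_one_of_index hn hj
    rw [birthRate_eq hn, deathRate_succ_eq]
    set s := Real.sigmoid (4 * β / n * ((j : ℝ) - (n : ℝ) / 2 + 1 / 2))
    have hs0 : 0 ≤ s := Real.sigmoid_nonneg _
    have hs1 : s ≤ 1 := Real.sigmoid_le_one _
    have h1 := mul_nonneg h.1 hs0
    have h2 := mul_le_mul_of_nonneg_right h' (by linarith : 0 ≤ 1 - s)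
    linarith

theorem sigmoid_step (hn : 1 ≤ n) (hβ₀ : 0 ≤ β) {x y : ℝ} (hxy : y = x + 1) :
    Real.sigmoid (4 * β / n * x) ≤ Real.sigmoid (4 * β / n * y) ∧
    Real.sigmoid (4 * β / n * y) - Real.sigmoid (4 * β / n * x) ≤ β / n := by
  have h0 : (0 : ℝ) ≤ 4 * β / n := by positivity
  have h : 4 * β / n * x ≤ 4 * β / n * y := mul_le_mul_of_nonneg_left (by linarith) h0
  refine ⟨Real.sigmoid_le h, (sigmoid_sub_le h).trans (le_of_eq ?_)⟩
  rw [hxy]; ring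

/-- With x = j/n and s₀, s₁, s₂ the sigmoids at k-1/2, k+1/2, k+3/2, the right side equals 1/n -
x(s₁-s₀) - (1-x-1/n)(s₂-s₁), and each sigmoid increment is at most β/n. -/
theorem rates_contract (hn : 1 ≤ n) (hβ₀ : 0 ≤ β) (j : ℕ) (hj : j < n) :
    (1 - β) / n ≤ (birthRate n β j - birthRate n β (j + 1)) +
      (deathRate n β (j + 1) - deathRate n β j) := by
  have h := div_le_one_of_index hn hj.le
  have h' := div_add_le_one_of_index hn hj
  rw [birthRate_eq hn β j, deathRate_eq n β j, deathRate_succ_eq, birthRate_succ_eq hn]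
  have h1 := (sigmoid_step hn hβ₀ (x := (j : ℝ) - (n : ℝ) / 2 - 1 / 2)
    (y := (j : ℝ) - (n : ℝ) / 2 + 1 / 2) (by ring)).2
  have h2 := (sigmoid_step hn hβ₀ (x := (j : ℝ) - (n : ℝ) / 2 + 1 / 2)
    (y := (j : ℝ) - (n : ℝ) / 2 + 3 / 2) (by ring)).2
  have h3 := mul_le_mul_of_nonneg_left h1 h.1
  have h4 := mul_le_mul_of_nonneg_left h2 (by linarith : 0 ≤ 1 - (j : ℝ) / n - 1 / n)
  have h5 : 0 ≤ (1 / (n : ℝ)) * (β / n) := by positivity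
  have h6 : (1 - β) / (n : ℝ) = 1 / n - β / n := by ring
  linarith

/-- Uniform ellipticity: on the state space the argument is at most 2β(n+1)/n ≤ 4 in absolute value.
-/
theorem sigmoid_neg_four_le (hn : 1 ≤ n) (hβ₀ : 0 ≤ β) (hβ₁ : β ≤ 1) {x : ℝ}
    (hx : |x| ≤ (n : ℝ) / 2 + 1 / 2) :
    Real.sigmoid (-4) ≤ Real.sigmoid (4 * β / n * x) ∧
      Real.sigmoid (-4) ≤ 1 - Real.sigmoid (4 * β / n * x) := by
  have hn' : (1 : ℝ) ≤ n := by exact_mod_cast hn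
  have h : |4 * β / n * x| ≤ 4 := by
    have h0 : (0 : ℝ) ≤ 4 * β / n := by positivity
    rw [abs_mul, abs_of_nonneg h0, div_mul_eq_mul_div, div_le_iff₀ (by positivity)]
    nlinarith [abs_nonneg x]
  rw [abs_le] at h
  rw [← Real.sigmoid_neg]
  exact ⟨Real.sigmoid_le h.1, Real.sigmoid_le (by linarith)⟩

theorem abs_index_le {j : ℕ} (hj : j ≤ n) :
    |(j : ℝ) - (n : ℝ) / 2 + 1 / 2| ≤ (n : ℝ) / 2 + 1 / 2 ∧
      |(j : ℝ) - (n : ℝ) / 2 - 1 / 2| ≤ (n : ℝ) / 2 + 1 / 2 := by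
  have h : (j : ℝ) ≤ n := by exact_mod_cast hj
  have h0 : (0 : ℝ) ≤ j := by positivity
  constructor <;> rw [abs_le] <;> constructor <;> linarith

theorem rates_hold (hn : 1 ≤ n) (hβ₀ : 0 ≤ β) (hβ₁ : β ≤ 1) (j : ℕ) (hj : j ≤ n) :
    Real.sigmoid (-4) ≤ 1 - birthRate n β j - deathRate n β j := by
  have h := div_le_one_of_index hn hj
  have h1 := (sigmoid_neg_four_le hn hβ₀ hβ₁ (abs_index_le hj).1).2
  have h2 := (sigmoid_neg_four_le hn hβ₀ hβ₁ (abs_index_le hj).2).1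
  rw [birthRate_eq hn, deathRate_eq]
  have h3 := mul_le_mul_of_nonneg_left h1 (by linarith [h.2] : 0 ≤ 1 - (j : ℝ) / n)
  have h4 := mul_le_mul_of_nonneg_left h2 h.1
  linarith

/-- The birth rate degenerates at the top, so gradient bounds weighted by it are useful only below a
level such as 3n/4. -/
theorem birthRate_ge (hn : 1 ≤ n) (hβ₀ : 0 ≤ β) (hβ₁ : β ≤ 1) (j : ℕ)
    (hj : (j : ℝ) ≤ 3 / 4 * n) : Real.sigmoid (-4) / 4 ≤ birthRate n β j := by
  have hn' : (0 : ℝ) < n := by positivity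
  have hj' : j ≤ n := by
    have : (j : ℝ) ≤ n := by linarith
    exact_mod_cast this
  have h1 := (sigmoid_neg_four_le hn hβ₀ hβ₁ (abs_index_le hj').1).1
  have h2 : (j : ℝ) / n ≤ 3 / 4 := (div_le_iff₀ hn').2 hj
  rw [birthRate_eq hn]
  have := mul_le_mul (by linarith : (1 : ℝ) / 4 ≤ 1 - (j : ℝ) / n) h1 (Real.sigmoid_nonneg _)
    (by linarith)
  linarith

/-- The growth factor of the weighted gradient in one step. -/
def gradFactor (n : ℕ) : ℝ := 1 + 1 / (Real.sigmoid (-4) * n)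

theorem one_le_gradFactor (n : ℕ) : 1 ≤ gradFactor n := by
  have := Real.sigmoid_pos (-4)
  rw [gradFactor]
  have : 0 ≤ 1 / (Real.sigmoid (-4) * n) := by positivity
  linarith

theorem birthRate_succ_le (hn : 1 ≤ n) (hβ₀ : 0 ≤ β) (hβ₁ : β ≤ 1) (j : ℕ) (hj : j < n) :
    birthRate n β (j + 1) ≤ gradFactor n * birthRate n β j := by
  have hn' : (0 : ℝ) < n := by positivity
  have h := div_le_one_of_index hn hj.le
  have h' := div_add_le_one_of_index hn hj
  have hc := Real.sigmoid_pos (-4)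
  have h1 := (sigmoid_neg_four_le hn hβ₀ hβ₁ (abs_index_le hj.le).1).1
  have h2 := (sigmoid_step hn hβ₀ (x := (j : ℝ) - (n : ℝ) / 2 + 1 / 2)
    (y := (j : ℝ) - (n : ℝ) / 2 + 3 / 2) (by ring)).2
  rw [birthRate_eq hn β j, birthRate_succ_eq hn]
  set s := Real.sigmoid (4 * β / n * ((j : ℝ) - (n : ℝ) / 2 + 1 / 2))
  set s' := Real.sigmoid (4 * β / n * ((j : ℝ) - (n : ℝ) / 2 + 3 / 2))
  have h3 : s' ≤ gradFactor n * s := by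
    have e : gradFactor n * s = s + (1 / n) * (s / Real.sigmoid (-4)) := by
      rw [gradFactor]; field_simp
    have h4 : (1 : ℝ) ≤ s / Real.sigmoid (-4) := (one_le_div hc).2 h1
    have h5 : β / n ≤ 1 / n := div_le_div_of_nonneg_right hβ₁ hn'.le
    have h6 := mul_le_mul_of_nonneg_left h4 (by positivity : (0 : ℝ) ≤ 1 / n)
    linarith
  have hs' : 0 ≤ s' := Real.sigmoid_nonneg _
  have h7 : 0 ≤ 1 / (n : ℝ) * s' := by positivity
  have h8 := mul_le_mul_of_nonneg_left h3 (by linarith [h.2] : 0 ≤ 1 - (j : ℝ) / n)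
  linarith

/-- Replacing `q (j + 1)` by `q j` costs at most 1/n, and a holding probability bounded below turns
this additive error into a multiplicative one. -/
theorem hold_edge_le (hn : 1 ≤ n) (hβ₀ : 0 ≤ β) (hβ₁ : β ≤ 1) (j : ℕ) (hj : j < n) :
    1 - birthRate n β j - deathRate n β (j + 1) ≤
      gradFactor n * (1 - birthRate n β j - deathRate n β j) := by
  have hn' : (0 : ℝ) < n := by positivity
  have h := div_le_one_of_index hn hj.le
  have hc := Real.sigmoid_pos (-4)
  have h0 := rates_hold hn hβ₀ hβ₁ j hj.le
  have h1 : deathRate n β j - deathRate n β (j + 1) ≤ 1 / n := by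
    have h2 := (sigmoid_step hn hβ₀ (x := (j : ℝ) - (n : ℝ) / 2 - 1 / 2)
      (y := (j : ℝ) - (n : ℝ) / 2 + 1 / 2) (by ring)).2
    rw [deathRate_eq n β j, deathRate_succ_eq]
    set s := Real.sigmoid (4 * β / n * ((j : ℝ) - (n : ℝ) / 2 + 1 / 2))
    set s' := Real.sigmoid (4 * β / n * ((j : ℝ) - (n : ℝ) / 2 - 1 / 2))
    have hs : s ≤ 1 := Real.sigmoid_le_one _
    have h5 : β / n ≤ 1 / n := div_le_div_of_nonneg_right hβ₁ hn'.le
    have h6 := mul_le_mul_of_nonneg_left (h2.trans h5) h.1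
    have h7 : (j : ℝ) / n * (1 / n) ≤ 1 / n := mul_le_of_le_one_left (by positivity) h.2
    have h8 : 0 ≤ 1 / (n : ℝ) * (1 - s) := mul_nonneg (by positivity) (by linarith)
    linarith
  set r := 1 - birthRate n β j - deathRate n β j with hr
  have e : gradFactor n * r = r + (1 / n) * (r / Real.sigmoid (-4)) := by
    rw [gradFactor]; field_simp
  have h4 : (1 : ℝ) ≤ r / Real.sigmoid (-4) := (one_le_div hc).2 h0
  have h6 := mul_le_mul_of_nonneg_left h4 (by positivity : (0 : ℝ) ≤ 1 / n)
  linarith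

/-- The drift at magnetization `k`. -/
theorem drift_eq (hn : 1 ≤ n) (β k : ℝ) : upRate n β k - downRate n β k =
    -(k / n) + (1 / 2) * ((Real.sigmoid (4 * β / n * (k + 1 / 2)) - 1 / 2) +
      (Real.sigmoid (4 * β / n * (k - 1 / 2)) - 1 / 2)) -
      k / n * (Real.sigmoid (4 * β / n * (k + 1 / 2)) -
        Real.sigmoid (4 * β / n * (k - 1 / 2))) := by
  have : (n : ℝ) ≠ 0 := by positivity
  rw [upRate_eq, downRate_eq]
  field_simp
  ring

/-- Positive magnetizations are at least 1/2, so both sigmoid arguments are nonnegative and the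
linear upper bound applies. The last term of `drift_eq` has a favourable sign. -/
theorem drift_le (hn : 1 ≤ n) (hβ₀ : 0 ≤ β) {k : ℝ} (hk : 1 / 2 ≤ k) :
    upRate n β k - downRate n β k ≤ -((1 - β) / n * k) := by
  have h0 : (0 : ℝ) ≤ 4 * β / n := by positivity
  have h1 := (sigmoid_step hn hβ₀ (x := k - 1 / 2) (y := k + 1 / 2) (by ring)).1
  have h2 := sigmoid_sub_le (mul_nonneg h0 (by linarith : 0 ≤ k + 1 / 2))
  have h3 := sigmoid_sub_le (mul_nonneg h0 (by linarith : 0 ≤ k - 1 / 2))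
  rw [Real.sigmoid_zero] at h2 h3
  have h4 := mul_nonneg (by positivity : 0 ≤ k / n) (sub_nonneg.2 h1)
  rw [drift_eq hn]
  have e : -((1 - β) / n * k) = -(k / n) + (1 / 2) * ((4 * β / n * (k + 1 / 2) - 0) / 4 +
    (4 * β / n * (k - 1 / 2) - 0) / 4) := by ring
  rw [e]
  linarith

theorem drift_ge (hn : 1 ≤ n) (hβ₀ : 0 ≤ β) (hβ₁ : β ≤ 1) {k : ℝ} (hk : 1 / 2 ≤ k) :
    -(1 - β) * (k / n) - 6 * (k / n) ^ 3 - k / n / n ≤ upRate n β k - downRate n β k := by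
  have hn' : (0 : ℝ) < n := by positivity
  have h0 : (0 : ℝ) ≤ 4 * β / n := by positivity
  have h1 := (sigmoid_step hn hβ₀ (x := k - 1 / 2) (y := k + 1 / 2) (by ring)).2
  have ha := mul_nonneg h0 (by linarith : 0 ≤ k + 1 / 2)
  have hb := mul_nonneg h0 (by linarith : 0 ≤ k - 1 / 2)
  have h2 := le_sigmoid ha
  have h3 := le_sigmoid hb
  have hkn : 0 ≤ k / n := by positivity
  have h4 := mul_le_mul_of_nonneg_left h1 hkn
  have h5 : k / n * (β / n) ≤ k / n / n := by
    rw [div_eq_mul_one_div (k / n) (n : ℝ)]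
    exact mul_le_mul_of_nonneg_left (div_le_div_of_nonneg_right hβ₁ hn'.le) hkn
  -- Since 1/2 ≤ k, the two arguments are at most 8k/n and 4k/n; the constant 6 is (8³ + 4³)/(2·48).
  have h6 : 4 * β / n * (k + 1 / 2) ≤ 8 * (k / n) := by
    rw [div_mul_eq_mul_div, ← mul_div_assoc]
    exact div_le_div_of_nonneg_right (by nlinarith) hn'.le
  have h7 : 4 * β / n * (k - 1 / 2) ≤ 4 * (k / n) := by
    rw [div_mul_eq_mul_div, ← mul_div_assoc]
    exact div_le_div_of_nonneg_right (by nlinarith) hn'.le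
  have h8 := pow_le_pow_left₀ ha h6 3
  have h9 := pow_le_pow_left₀ hb h7 3
  rw [drift_eq hn]
  have e : (4 * β / n * (k + 1 / 2)) / 4 + (4 * β / n * (k - 1 / 2)) / 4 = 2 * β * (k / n) := by
    ring
  have h10 : (8 * (k / n)) ^ 3 + (4 * (k / n)) ^ 3 = 576 * (k / n) ^ 3 := by ring
  linarith

theorem drift_mul_le (hn : 1 ≤ n) (hβ₀ : 0 ≤ β) (j : ℕ) :
    ((j : ℝ) - (n : ℝ) / 2) * (birthRate n β j - deathRate n β j) ≤
      -((1 - β) / n) * ((j : ℝ) - (n : ℝ) / 2) ^ 2 := by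
  have key : ∀ k : ℝ, 1 / 2 ≤ k →
      k * (upRate n β k - downRate n β k) ≤ -((1 - β) / n) * k ^ 2 := fun k hk => by
    have := mul_le_mul_of_nonneg_left (drift_le hn hβ₀ hk) (by linarith : 0 ≤ k)
    linarith
  rw [birthRate, deathRate]
  -- The magnetization is a half-integer: it is zero, at least 1/2, or at most -1/2, and the last
  -- case follows by spin flip.
  have h2 : (2 * j : ℤ) ≤ (n : ℤ) - 1 ∨ (2 * j : ℤ) = n ∨ (n : ℤ) + 1 ≤ 2 * j := by omega
  rcases h2 with h | h | h
  · have h' : (2 * j : ℝ) ≤ (n : ℝ) - 1 := by exact_mod_cast h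
    have := key (-((j : ℝ) - (n : ℝ) / 2)) (by linarith)
    rw [← downRate_eq_upRate_neg, downRate_eq_upRate_neg n β (-((j : ℝ) - (n : ℝ) / 2)),
      neg_neg] at this
    linarith
  · have h' : (2 * j : ℝ) = n := by exact_mod_cast h
    have : (j : ℝ) - (n : ℝ) / 2 = 0 := by linarith
    rw [this]; simp
  · have h' : (n : ℝ) + 1 ≤ 2 * j := by exact_mod_cast h
    exact key _ (by linarith)

end Rates

/-! ### The Glauber dynamics -/

theorem spin_sq {n : ℕ} (σ : Config n) (i : Fin n) : spin σ i ^ 2 = 1 := by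
  rcases Int.units_eq_one_or (σ i) with h | h <;> simp [spin, h]

theorem spin_update_self {n : ℕ} (σ : Config n) (i : Fin n) (s : ℤˣ) :
    spin (Function.update σ i s) i = ((s : ℤ) : ℝ) := by
  simp [spin]

theorem localField_update {n : ℕ} (σ : Config n) (i : Fin n) (s : ℤˣ) :
    localField (Function.update σ i s) i = localField σ i := by
  unfold localField
  congr 1
  refine Finset.sum_congr rfl fun j hj => ?_
  simp [spin, Function.update_of_ne (Finset.ne_of_mem_erase hj)]

theorem energy_eq {n : ℕ} (σ : Config n) :
    energy σ = -(1 / (n : ℝ)) * (((2 * magnetization σ) ^ 2 - n) / 2) := by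
  have h1 : (∑ i, spin σ i) ^ 2 = ∑ i, spin σ i ^ 2 +
      2 * ∑ i : Fin n, ∑ j ∈ Finset.Ioi i, spin σ i * spin σ j := by
    have h2 : ∀ i : Fin n, (∑ j, spin σ i * spin σ j) = spin σ i ^ 2 +
        ∑ j ∈ Finset.Ioi i, spin σ i * spin σ j + ∑ j ∈ Finset.Iio i, spin σ i * spin σ j := by
      intro i
      rw [← Finset.sum_erase_add _ _ (Finset.mem_univ i)]
      have : Finset.univ.erase i = Finset.Ioi i ∪ Finset.Iio i := by
        ext j
        simp only [Finset.mem_erase, Finset.mem_univ, and_true, Finset.mem_union, Finset.mem_Ioi,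
          Finset.mem_Iio]
        exact ⟨fun h => (lt_or_gt_of_ne h).symm, fun h => h.elim ne_of_gt ne_of_lt⟩
      rw [this, Finset.sum_union (Finset.disjoint_left.2 fun j h1 h2 =>
        absurd (Finset.mem_Ioi.1 h1) (Finset.mem_Iio.1 h2).asymm)]
      ring
    have h3 : ∑ i : Fin n, ∑ j ∈ Finset.Iio i, spin σ i * spin σ j =
        ∑ i : Fin n, ∑ j ∈ Finset.Ioi i, spin σ i * spin σ j := by
      rw [Finset.sum_comm' (t' := Finset.univ) (s' := fun j => Finset.Ioi j) (by simp)]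
      exact Finset.sum_congr rfl fun i _ => Finset.sum_congr rfl fun j _ => mul_comm _ _
    rw [sq, Finset.sum_mul_sum, Finset.sum_congr rfl fun i _ => h2 i, Finset.sum_add_distrib,
      Finset.sum_add_distrib, h3]
    ring
  rw [energy, magnetization]
  congr 1
  have h4 : 2 * (1 / 2 * ∑ i, spin σ i) = ∑ i, spin σ i := by ring
  rw [h4, h1, Finset.sum_congr rfl fun i _ => spin_sq σ i]
  simp

theorem two_mul_magnetization {n : ℕ} (hn : 1 ≤ n) (σ : Config n) (i : Fin n) :
    2 * magnetization σ = spin σ i + n * localField σ i := by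
  have : (n : ℝ) ≠ 0 := by positivity
  rw [magnetization, localField, ← Finset.add_sum_erase _ _ (Finset.mem_univ i)]
  field_simp

/-- Isolates the dependence on spin `i`: the second summand involves only the local field, which an
update at `i` leaves unchanged. -/
theorem neg_energy_eq {n : ℕ} (hn : 1 ≤ n) (σ : Config n) (i : Fin n) :
    -energy σ = spin σ i * localField σ i +
      (1 + (n * localField σ i) ^ 2 - n) / (2 * n) := by
  have : (n : ℝ) ≠ 0 := by positivity
  rw [energy_eq, two_mul_magnetization hn σ i]
  have h := spin_sq σ i
  field_simp
  linear_combination h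

theorem partitionFn_pos (n : ℕ) (β : ℝ) : 0 < partitionFn n β :=
  Finset.sum_pos (fun _ _ => Real.exp_pos _) Finset.univ_nonempty

theorem gibbs_pos {n : ℕ} (β : ℝ) (σ : Config n) : 0 < gibbs n β σ :=
  div_pos (Real.exp_pos _) (partitionFn_pos n β)

theorem gibbs_mem_stdSimplex (n : ℕ) (β : ℝ) : gibbs n β ∈ stdSimplex ℝ (Config n) := by
  refine ⟨fun σ => (gibbs_pos β σ).le, ?_⟩
  simp only [gibbs]
  rw [← Finset.sum_div]
  exact div_self (partitionFn_pos n β).ne'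

theorem gibbs_congr {n : ℕ} (β : ℝ) {σ τ : Config n} (h : magnetization σ = magnetization τ) :
    gibbs n β σ = gibbs n β τ := by
  rw [gibbs, gibbs, energy_eq, energy_eq, h]

theorem updateProb_pos {n : ℕ} (β : ℝ) (σ : Config n) (i : Fin n) (s : ℤˣ) :
    0 < updateProb β σ i s := by
  unfold updateProb; positivity

theorem sum_units (f : ℤˣ → ℝ) : ∑ s : ℤˣ, f s = f 1 + f (-1) := by
  have : (Finset.univ : Finset ℤˣ) = {1, -1} := rfl
  rw [this, Finset.sum_pair (by decide)]

theorem sum_updateProb {n : ℕ} (β : ℝ) (σ : Config n) (i : Fin n) :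
    ∑ s : ℤˣ, updateProb β σ i s = 1 := by
  rw [sum_units]
  unfold updateProb
  have : Real.exp (β * localField σ i) + Real.exp (-(β * localField σ i)) ≠ 0 := by positivity
  rw [← add_div, div_eq_one_iff_eq this]
  simp

/-- The update law is the conditional Gibbs law of the spin given the others, so the product is
symmetric in the old and new values. -/
theorem gibbs_mul_updateProb {n : ℕ} (hn : 1 ≤ n) (β : ℝ) (σ : Config n) (i : Fin n) (s : ℤˣ) :
    gibbs n β σ * updateProb β σ i s =
      gibbs n β (Function.update σ i s) * updateProb β (Function.update σ i s) i (σ i) := by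
  unfold gibbs updateProb
  rw [localField_update, div_mul_div_comm, div_mul_div_comm]
  congr 1
  rw [← Real.exp_add, ← Real.exp_add]
  congr 1
  have h1 := neg_energy_eq hn σ i
  have h2 := neg_energy_eq hn (Function.update σ i s) i
  rw [localField_update, spin_update_self] at h2
  have h3 : ((σ i : ℤ) : ℝ) = spin σ i := rfl
  rw [h3]
  linear_combination β * h1 - β * h2

theorem glauber_apply {n : ℕ} (β : ℝ) (σ τ : Config n) :
    glauber n β σ τ = (1 / (n : ℝ)) * ∑ i : Fin n, ∑ s : ℤˣ,
      updateProb β σ i s * (if τ = Function.update σ i s then 1 else 0) := rfl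

theorem sum_glauber_mul {n : ℕ} (β : ℝ) (σ : Config n) (f : Config n → ℝ) :
    ∑ τ, glauber n β σ τ * f τ = (1 / (n : ℝ)) * ∑ i : Fin n, ∑ s : ℤˣ,
      updateProb β σ i s * f (Function.update σ i s) := by
  simp only [glauber_apply]
  simp only [mul_assoc, ← Finset.mul_sum]
  congr 1
  simp only [Finset.sum_mul]
  rw [Finset.sum_comm]
  refine Finset.sum_congr rfl fun i _ => ?_
  rw [Finset.sum_comm]
  refine Finset.sum_congr rfl fun s _ => ?_
  simp

theorem glauber_mem_rowStochastic {n : ℕ} (hn : 1 ≤ n) (β : ℝ) :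
    glauber n β ∈ Matrix.rowStochastic ℝ (Config n) := by
  rw [Matrix.mem_rowStochastic_iff_sum]
  have : (n : ℝ) ≠ 0 := by positivity
  refine ⟨fun σ τ => ?_, fun σ => ?_⟩
  · rw [glauber_apply]
    refine mul_nonneg (by positivity) (Finset.sum_nonneg fun i _ => Finset.sum_nonneg fun s _ =>
      mul_nonneg (updateProb_pos β σ i s).le ?_)
    split_ifs <;> norm_num
  · have := sum_glauber_mul β σ fun _ => 1
    simp only [mul_one, sum_updateProb] at this
    rw [this]
    simp; field_simp

/-- Detailed balance. -/
theorem gibbs_mul_glauber {n : ℕ} (hn : 1 ≤ n) (β : ℝ) (σ τ : Config n) :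
    gibbs n β σ * glauber n β σ τ = gibbs n β τ * glauber n β τ σ := by
  have key : ∀ (i : Fin n) (σ τ : Config n),
      gibbs n β σ * ∑ s : ℤˣ, updateProb β σ i s * (if τ = Function.update σ i s then 1 else 0) =
        if τ = Function.update σ i (τ i) then gibbs n β σ * updateProb β σ i (τ i) else 0 := by
    intro i σ τ
    rw [Finset.sum_eq_single (τ i)]
    · split_ifs <;> simp only [mul_one, mul_zero]
    · intro s _ hs
      rw [if_neg, mul_zero]
      rintro rfl
      simp at hs
    · exact fun h => absurd (Finset.mem_univ _) h
  rw [glauber_apply, glauber_apply, mul_left_comm, mul_left_comm (gibbs n β τ),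
    Finset.mul_sum (a := gibbs n β σ), Finset.mul_sum (a := gibbs n β τ)]
  congr 1
  refine Finset.sum_congr rfl fun i _ => ?_
  rw [key, key]
  have hiff : ∀ σ τ : Config n, τ = Function.update σ i (τ i) → σ = Function.update τ i (σ i) := by
    intro σ τ h
    rw [h]
    simp
  by_cases h : τ = Function.update σ i (τ i)
  · rw [if_pos h, if_pos (hiff _ _ h), gibbs_mul_updateProb hn, ← h]
  · rw [if_neg h, if_neg fun h' => h (hiff _ _ h')]

/-- By reversibility, densities with respect to the Gibbs measure evolve as functions under the same
matrix. -/
theorem vecMul_glauber {n : ℕ} (hn : 1 ≤ n) (β : ℝ) (l : Config n → ℝ) (τ : Config n) :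
    (l ᵥ* glauber n β) τ =
      gibbs n β τ * ∑ σ, glauber n β τ σ * (l σ / gibbs n β σ) := by
  rw [Matrix.vecMul, dotProduct, Finset.mul_sum]
  refine Finset.sum_congr rfl fun σ _ => ?_
  have h := gibbs_mul_glauber hn β σ τ
  have h0 := (gibbs_pos β σ).ne'
  field_simp
  linear_combination l σ * h

theorem gibbs_vecMul_glauber {n : ℕ} (hn : 1 ≤ n) (β : ℝ) :
    gibbs n β ᵥ* glauber n β = gibbs n β := by
  ext τ
  rw [vecMul_glauber hn]
  simp only [div_self (gibbs_pos β _).ne', mul_one]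
  rw [Matrix.sum_row_of_mem_rowStochastic (glauber_mem_rowStochastic hn β), mul_one]

/-- Harmonic functions of the Glauber dynamics are constant. -/
theorem eq_of_glauber_harmonic {n : ℕ} (hn : 1 ≤ n) (β : ℝ) {f : Config n → ℝ}
    (hf : ∀ σ, ∑ τ, glauber n β σ τ * f τ = f σ) (σ τ : Config n) : f σ = f τ := by
  have hn0 : (n : ℝ) ≠ 0 := by positivity
  obtain ⟨σ₀, hσ₀⟩ := Finite.exists_max f
  -- Maximum principle: the value at a maximum is an average with positive weights over all
  -- single-site updates, so each update is again a maximum.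
  have step : ∀ σ, f σ = f σ₀ → ∀ i s, f (Function.update σ i s) = f σ₀ := by
    intro σ hσ
    have h1 := hf σ
    rw [sum_glauber_mul, hσ] at h1
    have h2 : ∑ i : Fin n, ∑ s : ℤˣ,
        updateProb β σ i s * (f σ₀ - f (Function.update σ i s)) = 0 := by
      simp only [mul_sub, Finset.sum_sub_distrib, ← Finset.sum_mul, sum_updateProb]
      rw [one_div, inv_mul_eq_iff_eq_mul₀ hn0] at h1
      rw [h1]; simp
    have hnn : ∀ i s, 0 ≤ updateProb β σ i s * (f σ₀ - f (Function.update σ i s)) := fun i s =>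
      mul_nonneg (updateProb_pos β σ i s).le (sub_nonneg.2 (hσ₀ _))
    intro i s
    rw [Finset.sum_eq_zero_iff_of_nonneg fun i _ => Finset.sum_nonneg fun s _ => hnn i s] at h2
    have h3 := h2 i (Finset.mem_univ i)
    rw [Finset.sum_eq_zero_iff_of_nonneg fun s _ => hnn i s] at h3
    have h4 := (mul_eq_zero.1 (h3 s (Finset.mem_univ s))).resolve_left (updateProb_pos β σ i s).ne'
    linarith
  have all : ∀ τ, f τ = f σ₀ := by
    intro τ
    have : ∀ S : Finset (Fin n), f (S.piecewise τ σ₀) = f σ₀ := by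
      intro S
      induction S using Finset.induction_on with
      | empty => simp
      | insert i S _ ih =>
        rw [Finset.piecewise_insert]
        exact step _ ih _ _
    simpa using this Finset.univ
  rw [all σ, all τ]

/-- The density of a stationary law is harmonic, hence constant. -/
theorem glauber_isUniqueStationary {n : ℕ} (hn : 1 ≤ n) (β : ℝ) :
    IsUniqueStationary (glauber n β) (gibbs n β) := by
  refine ⟨gibbs_mem_stdSimplex n β, fun ν hν => ⟨fun h => ?_, fun h => h ▸
    gibbs_vecMul_glauber hn β⟩⟩
  have hconst := eq_of_glauber_harmonic hn β (f := fun σ => ν σ / gibbs n β σ) fun σ => by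
    have := vecMul_glauber hn β ν σ
    rw [h] at this
    rw [this, mul_div_cancel_left₀ _ (gibbs_pos β σ).ne']
  have h1 : ∀ σ, ν σ = ν 1 / gibbs n β 1 * gibbs n β σ := fun σ => by
    rw [← hconst σ 1, div_mul_cancel₀ _ (gibbs_pos β σ).ne']
  have h2 := hν.2
  rw [Finset.sum_congr rfl fun σ _ => h1 σ, ← Finset.mul_sum, (gibbs_mem_stdSimplex n β).2,
    mul_one] at h2
  ext σ
  rw [h1, h2, one_mul]

/-! ### The projection to the magnetization -/

theorem magIndex_eq_iff {n : ℕ} (σ τ : Config n) :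
    magIndex σ = magIndex τ ↔ magnetization σ = magnetization τ := by
  rw [← magValue_magIndex, ← magValue_magIndex]
  refine ⟨fun h => by rw [h], fun h => ?_⟩
  simp only [magValue, sub_left_inj, Nat.cast_inj] at h
  exact Fin.ext h

theorem magnetization_update {n : ℕ} (hn : 1 ≤ n) (σ : Config n) (i : Fin n) (s : ℤˣ) :
    magnetization (Function.update σ i s) = magnetization σ + (((s : ℤ) : ℝ) - spin σ i) / 2 := by
  have h1 := two_mul_magnetization hn σ i
  have h2 := two_mul_magnetization hn (Function.update σ i s) i
  rw [localField_update, spin_update_self] at h2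
  linarith

theorem magIndex_update {n : ℕ} (hn : 1 ≤ n) (σ : Config n) (i : Fin n) (s : ℤˣ) :
    ((magIndex (Function.update σ i s) : ℕ) : ℝ) =
      (magIndex σ : ℕ) + (((s : ℤ) : ℝ) - spin σ i) / 2 := by
  have := magnetization_update hn σ i s
  rw [← magValue_magIndex, ← magValue_magIndex, magValue, magValue] at this
  linarith

/-- The shift by 1/2 removes the contribution of the updated spin from the magnetization. -/
theorem updateProb_neg_one {n : ℕ} (hn : 1 ≤ n) (β : ℝ) {σ : Config n} {i : Fin n}
    (h : σ i = 1) : updateProb β σ i (-1) =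
      1 / (1 + Real.exp ((4 * β / n) * (magnetization σ - 1 / 2))) := by
  have h0 : (n : ℝ) ≠ 0 := by positivity
  have h1 := two_mul_magnetization hn σ i
  have h2 : spin σ i = 1 := by simp [spin, h]
  have h3 : (4 * β / n) * (magnetization σ - 1 / 2) =
      β * localField σ i + β * localField σ i := by
    rw [h2] at h1
    field_simp
    linear_combination 4 * β * h1
  have h4 : β * (((-1 : ℤˣ) : ℤ) : ℝ) * localField σ i = -(β * localField σ i) := by
    push_cast; ring
  rw [updateProb, h3, h4, Real.exp_neg, Real.exp_add]
  have := Real.exp_pos (β * localField σ i)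
  field_simp
  ring

theorem updateProb_one {n : ℕ} (hn : 1 ≤ n) (β : ℝ) {σ : Config n} {i : Fin n}
    (h : σ i = -1) : updateProb β σ i 1 =
      1 / (1 + Real.exp (-(4 * β / n) * (magnetization σ + 1 / 2))) := by
  have h0 : (n : ℝ) ≠ 0 := by positivity
  have h1 := two_mul_magnetization hn σ i
  have h2 : spin σ i = -1 := by simp [spin, h]
  have h3 : -(4 * β / n) * (magnetization σ + 1 / 2) =
      -(β * localField σ i + β * localField σ i) := by
    rw [h2] at h1
    field_simp
    linear_combination -4 * β * h1
  have h4 : β * (((1 : ℤˣ) : ℤ) : ℝ) * localField σ i = β * localField σ i := by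
    push_cast; ring
  rw [updateProb, h3, h4, Real.exp_neg, Real.exp_neg, Real.exp_add]
  have := Real.exp_pos (β * localField σ i)
  field_simp

/-- The expected value of a function of the magnetization after one step of the Glauber
dynamics. -/
theorem sum_glauber_mul_magIndex {n : ℕ} (hn : 1 ≤ n) (β : ℝ) (σ : Config n) (g : ℕ → ℝ) :
    ∑ τ, glauber n β σ τ * g (magIndex τ) =
      bdOp (birthRate n β) (deathRate n β) g (magIndex σ) := by
  have h0 : (n : ℝ) ≠ 0 := by positivity
  rw [sum_glauber_mul, bdOp_apply, birthRate, deathRate]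
  have hk : ((magIndex σ : ℕ) : ℝ) - (n : ℝ) / 2 = magnetization σ := magValue_magIndex σ
  rw [hk]
  set a := 1 / (1 + Real.exp (-(4 * β / n) * (magnetization σ + 1 / 2))) with ha
  set b := 1 / (1 + Real.exp ((4 * β / n) * (magnetization σ - 1 / 2))) with hb
  have hterm : ∀ i : Fin n, ∑ s : ℤˣ, updateProb β σ i s * g (magIndex (Function.update σ i s)) =
      g (magIndex σ) + (if σ i = 1 then b * (g ((magIndex σ : ℕ) - 1) - g (magIndex σ)) else
        a * (g ((magIndex σ : ℕ) + 1) - g (magIndex σ))) := by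
    intro i
    have hs := sum_updateProb β σ i
    rw [sum_units] at hs ⊢
    rcases Int.units_eq_one_or (σ i) with h | h
    · have h1 : Function.update σ i 1 = σ := by rw [← h]; simp
      have h2 : (magIndex (Function.update σ i (-1)) : ℕ) = (magIndex σ : ℕ) - 1 := by
        have := magIndex_update hn σ i (-1)
        have h2 : spin σ i = 1 := by simp [spin, h]
        rw [h2] at this
        push_cast at this
        have h3 : ((magIndex (Function.update σ i (-1)) : ℕ) : ℝ) + 1 = (magIndex σ : ℕ) := by
          linarith
        have h4 : (magIndex (Function.update σ i (-1)) : ℕ) + 1 = (magIndex σ : ℕ) := by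
          exact_mod_cast h3
        omega
      rw [if_pos h, h1, h2, hb, ← updateProb_neg_one hn β h]
      linear_combination g (magIndex σ) * hs
    · have h1 : Function.update σ i (-1) = σ := by rw [← h]; simp
      have h2 : (magIndex (Function.update σ i 1) : ℕ) = (magIndex σ : ℕ) + 1 := by
        have := magIndex_update hn σ i 1
        have h2 : spin σ i = -1 := by simp [spin, h]
        rw [h2] at this
        push_cast at this
        have h3 : ((magIndex (Function.update σ i 1) : ℕ) : ℝ) = (magIndex σ : ℕ) + 1 := by
          linarith
        exact_mod_cast h3
      rw [if_neg (by rw [h]; decide), h1, h2, ha, ← updateProb_one hn β h]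
      linear_combination g (magIndex σ) * hs
  rw [Finset.sum_congr rfl fun i _ => hterm i, Finset.sum_add_distrib, Finset.sum_ite,
    Finset.sum_const, Finset.sum_const, Finset.sum_const, Finset.card_univ, Fintype.card_fin]
  have hc1 : (((Finset.univ.filter fun i => σ i = 1).card : ℕ) : ℝ) =
      magnetization σ + (n : ℝ) / 2 := by
    rw [← hk]; simp [magIndex]
  have hc2 : (((Finset.univ.filter fun i => ¬ σ i = 1).card : ℕ) : ℝ) =
      (n : ℝ) / 2 - magnetization σ := by
    have := Finset.card_filter_add_card_filter_not (s := (Finset.univ : Finset (Fin n)))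
      (fun i => σ i = 1)
    rw [Finset.card_univ, Fintype.card_fin] at this
    have h3 : (((Finset.univ.filter fun i => σ i = 1).card : ℕ) : ℝ) +
      ((Finset.univ.filter fun i => ¬ σ i = 1).card : ℕ) = n := by exact_mod_cast this
    linarith
  simp only [nsmul_eq_mul, hc1, hc2, upRate, downRate]
  rw [← ha, ← hb]
  field_simp
  ring

theorem magChain_apply {n : ℕ} (hn : 1 ≤ n) (β : ℝ) (i j : Fin (n + 1)) :
    magChain n β i j =
      bdOp (birthRate n β) (deathRate n β) (fun k => if k = j then 1 else 0) i := by
  have hq := (isMonotoneRates hn β).q_zero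
  have e1 : upRate n β (magValue i) = birthRate n β i := rfl
  have e2 : downRate n β (magValue i) = deathRate n β i := rfl
  rw [bdOp_apply, magChain, Matrix.of_apply, e1, e2]
  simp only [Fin.ext_iff]
  generalize (i : ℕ) = i
  generalize (j : ℕ) = j
  rcases i with _ | i
  · rw [hq]
    rcases j with _ | _ | j <;> simp
    ring
  · rcases lt_trichotomy j (i + 1) with h | rfl | h
    · rcases eq_or_ne j i with rfl | h'
      · have h1 : ¬ (j = j + 1 + 1) := by omega
        have h2 : ¬ (j + 1 + 1 = j) := by omega
        simp [h1, h2]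
      · have : ¬ (i + 1 = j) := by omega
        have h1 : ¬ (j = i + 1 + 1) := by omega
        have h2 : ¬ (i + 1 + 1 = j) := by omega
        simp [h', h'.symm, h.ne, this, h1, h2]
    · simp
      ring
    · rcases eq_or_ne j (i + 1 + 1) with rfl | h'
      · have h1 : ¬ (i = i + 1 + 1) := by omega
        simp [h1]
      · have h1 : ¬ (i = j) := by omega
        have h2 : ¬ (j = i) := by omega
        simp [h', h'.symm, h.ne, h.ne', h1, h2]

theorem magChain_mulVec {n : ℕ} (hn : 1 ≤ n) (β : ℝ) (g : ℕ → ℝ) (i : Fin (n + 1)) :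
    (magChain n β *ᵥ fun j => g j) i = bdOp (birthRate n β) (deathRate n β) g i := by
  have hM := isMonotoneRates hn β
  have hsum : ∀ k ≤ n, ∑ j : Fin (n + 1), (if k = (j : ℕ) then (1 : ℝ) else 0) * g j = g k := by
    intro k hk
    rw [Finset.sum_eq_single ⟨k, by omega⟩]
    · simp
    · intro j _ hj
      rw [if_neg, zero_mul]
      rintro rfl
      exact hj rfl
    · exact fun h => absurd (Finset.mem_univ _) h
  have hi : (i : ℕ) ≤ n := by omega
  rw [Matrix.mulVec, dotProduct]
  simp only [magChain_apply hn, bdOp_apply, add_mul, Finset.sum_add_distrib, mul_assoc, sub_mul,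
    ← Finset.mul_sum, Finset.sum_sub_distrib]
  rw [hsum _ hi, hsum (i - 1) (by omega)]
  rcases hi.lt_or_eq with h | h
  · rw [hsum (i + 1) h]
  · rw [h, hM.p_last]; ring

theorem magLaw_dotProduct {n : ℕ} (l : Config n → ℝ) (f : Fin (n + 1) → ℝ) :
    ∑ j, magLaw l j * f j = ∑ σ, l σ * f (magIndex σ) := by
  simp only [magLaw, Finset.sum_mul]
  rw [← Finset.sum_fiberwise Finset.univ magIndex fun σ => l σ * f (magIndex σ)]
  refine Finset.sum_congr rfl fun j _ => Finset.sum_congr rfl fun σ hσ => ?_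
  rw [(Finset.mem_filter.1 hσ).2]

/-- The magnetization chain is the projection of the Glauber dynamics. -/
theorem magLaw_glauber {n : ℕ} (hn : 1 ≤ n) (β : ℝ) (σ : Config n) (j : Fin (n + 1)) :
    magLaw (fun τ => glauber n β σ τ) j = magChain n β (magIndex σ) j := by
  rw [magChain_apply hn, ← sum_glauber_mul_magIndex hn, magLaw, Finset.sum_filter]
  refine Finset.sum_congr rfl fun τ _ => ?_
  simp [Fin.ext_iff]

theorem magLaw_vecMul {n : ℕ} (hn : 1 ≤ n) (β : ℝ) (l : Config n → ℝ) :
    magLaw (l ᵥ* glauber n β) = magLaw l ᵥ* magChain n β := by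
  ext j
  have h1 : (magLaw l ᵥ* magChain n β) j = ∑ σ, l σ * magChain n β (magIndex σ) j :=
    magLaw_dotProduct l fun i => magChain n β i j
  rw [h1]
  simp only [← magLaw_glauber hn]
  simp only [magLaw, Matrix.vecMul, dotProduct]
  rw [Finset.sum_comm]
  simp only [Finset.mul_sum]

/-! ### Evolution of laws and distances under the projection -/

theorem evolve_succ {Ω : Type} [Fintype Ω] [DecidableEq Ω] (P : Matrix Ω Ω ℝ) (μ₀ : Ω → ℝ)
    (t : ℕ) : evolve P μ₀ (t + 1) = evolve P μ₀ t ᵥ* P := by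
  rw [evolve, evolve, pow_succ, Matrix.vecMul_vecMul]

theorem magLaw_evolve {n : ℕ} (hn : 1 ≤ n) (β : ℝ) (l : Config n → ℝ) (t : ℕ) :
    magLaw (evolve (glauber n β) l t) = evolve (magChain n β) (magLaw l) t := by
  induction t with
  | zero => simp [evolve]
  | succ t ih => rw [evolve_succ, evolve_succ, magLaw_vecMul hn, ih]

theorem evolve_mem_stdSimplex {Ω : Type} [Fintype Ω] [DecidableEq Ω] {P : Matrix Ω Ω ℝ}
    (hP : P ∈ Matrix.rowStochastic ℝ Ω) {μ₀ : Ω → ℝ} (hμ : μ₀ ∈ stdSimplex ℝ Ω) (t : ℕ) :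
    evolve P μ₀ t ∈ stdSimplex ℝ Ω := by
  have hPt := pow_mem hP t
  refine ⟨fun x => Finset.sum_nonneg fun y _ => mul_nonneg (hμ.1 y)
    (Matrix.nonneg_of_mem_rowStochastic hPt), ?_⟩
  simp only [evolve, Matrix.vecMul, dotProduct]
  rw [Finset.sum_comm]
  simp only [← Finset.mul_sum, Matrix.sum_row_of_mem_rowStochastic hPt, mul_one]
  exact hμ.2

theorem magLaw_mem_stdSimplex {n : ℕ} {l : Config n → ℝ} (hl : l ∈ stdSimplex ℝ (Config n)) :
    magLaw l ∈ stdSimplex ℝ (Fin (n + 1)) := by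
  refine ⟨fun j => Finset.sum_nonneg fun σ _ => hl.1 σ, ?_⟩
  have := magLaw_dotProduct l fun _ => 1
  simp only [mul_one] at this
  rw [this]
  exact hl.2

theorem magIndex_surjective {n : ℕ} (j : Fin (n + 1)) : ∃ σ : Config n, magIndex σ = j := by
  refine ⟨fun i => if (i : ℕ) < j then 1 else -1, ?_⟩
  have : (Finset.univ.filter fun i : Fin n => (if (i : ℕ) < j then (1 : ℤˣ) else -1) = 1) =
      Finset.univ.filter fun i : Fin n => (i : ℕ) < j := by
    ext i
    simp only [Finset.mem_filter, Finset.mem_univ, true_and]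
    split_ifs with h
    · simp [h]
    · simp only [h, iff_false]; decide
  ext
  simp only [magIndex, this]
  rw [Fin.card_filter_val_lt]
  omega

/-- Every row is the image of a row of the Glauber matrix. -/
theorem magChain_mem_rowStochastic {n : ℕ} (hn : 1 ≤ n) (β : ℝ) :
    magChain n β ∈ Matrix.rowStochastic ℝ (Fin (n + 1)) := by
  have hG := Matrix.mem_rowStochastic_iff_sum.1 (glauber_mem_rowStochastic hn β)
  have : ∀ i : Fin (n + 1), magChain n β i ∈ stdSimplex ℝ (Fin (n + 1)) := by
    intro i
    obtain ⟨σ, rfl⟩ := magIndex_surjective i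
    have := magLaw_mem_stdSimplex (l := fun τ => glauber n β σ τ) ⟨hG.1 σ, hG.2 σ⟩
    rwa [funext (magLaw_glauber hn β σ)] at this
  exact Matrix.mem_rowStochastic_iff_sum.2 ⟨fun i => (this i).1, fun i => (this i).2⟩

/-- The density with respect to the Gibbs measure is a function of the magnetization, and such
functions are preserved by the dynamics. -/
theorem evolve_glauber_congr {n : ℕ} (hn : 1 ≤ n) (β : ℝ) {l : Config n → ℝ}
    (hl : ∀ σ τ : Config n, magnetization σ = magnetization τ → l σ = l τ) (t : ℕ) :
    ∀ σ τ : Config n, magnetization σ = magnetization τ →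
      evolve (glauber n β) l t σ = evolve (glauber n β) l t τ := by
  induction t with
  | zero => simpa [evolve] using hl
  | succ t ih =>
    intro σ τ h
    set f : Config n → ℝ := fun σ => evolve (glauber n β) l t σ / gibbs n β σ with hf
    obtain ⟨g, hg⟩ : ∃ g : ℕ → ℝ, ∀ σ, f σ = g (magIndex σ) := by
      choose r hr using magIndex_surjective (n := n)
      refine ⟨fun k => if hk : k < n + 1 then f (r ⟨k, hk⟩) else 0, fun σ => ?_⟩
      have h1 : magnetization σ = magnetization (r (magIndex σ)) :=
        (magIndex_eq_iff _ _).1 (hr _).symm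
      simp only [(magIndex σ).2, dif_pos, hf, Fin.eta]
      rw [ih _ _ h1, gibbs_congr β h1]
    rw [evolve_succ, vecMul_glauber hn, vecMul_glauber hn, gibbs_congr β h]
    have h2 : ∀ σ, ∑ τ, glauber n β σ τ * (evolve (glauber n β) l t τ / gibbs n β τ) =
        bdOp (birthRate n β) (deathRate n β) g (magIndex σ) := fun σ => by
      rw [← sum_glauber_mul_magIndex hn]
      exact Finset.sum_congr rfl fun τ _ => by rw [← hg τ]
    rw [h2, h2, (magIndex_eq_iff σ τ).2 h]

/-- On each fibre the difference is constant, so summing it loses nothing in absolute value. -/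
theorem tvDist_magLaw {n : ℕ} {μ ν : Config n → ℝ}
    (hμ : ∀ σ τ : Config n, magnetization σ = magnetization τ → μ σ = μ τ)
    (hν : ∀ σ τ : Config n, magnetization σ = magnetization τ → ν σ = ν τ) :
    tvDist μ ν = tvDist (magLaw μ) (magLaw ν) := by
  rw [tvDist, tvDist, ← Finset.sum_fiberwise Finset.univ magIndex fun σ => |μ σ - ν σ|]
  congr 1
  refine Finset.sum_congr rfl fun j _ => ?_
  obtain ⟨σ₀, rfl⟩ := magIndex_surjective j
  have h : ∀ σ ∈ Finset.univ.filter fun σ : Config n => magIndex σ = magIndex σ₀,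
      μ σ = μ σ₀ ∧ ν σ = ν σ₀ := fun σ hσ => by
    have := (magIndex_eq_iff _ _).1 (Finset.mem_filter.1 hσ).2
    exact ⟨hμ _ _ this, hν _ _ this⟩
  have h1 : ∑ σ ∈ Finset.univ.filter (fun σ : Config n => magIndex σ = magIndex σ₀), |μ σ - ν σ| =
      ∑ σ ∈ Finset.univ.filter (fun σ : Config n => magIndex σ = magIndex σ₀), |μ σ₀ - ν σ₀| :=
    Finset.sum_congr rfl fun σ hσ => by rw [(h σ hσ).1, (h σ hσ).2]
  have h2 : ∑ σ ∈ Finset.univ.filter (fun σ : Config n => magIndex σ = magIndex σ₀), (μ σ - ν σ) =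
      ∑ σ ∈ Finset.univ.filter (fun σ : Config n => magIndex σ = magIndex σ₀), (μ σ₀ - ν σ₀) :=
    Finset.sum_congr rfl fun σ hσ => by rw [(h σ hσ).1, (h σ hσ).2]
  rw [magLaw, magLaw, ← Finset.sum_sub_distrib, h1, h2]
  simp only [Finset.sum_const, nsmul_eq_mul, abs_mul, Nat.abs_cast]

theorem tvDist_glauber_eq {n : ℕ} (hn : 1 ≤ n) (β : ℝ) {l : Config n → ℝ}
    (hl : ∀ σ τ : Config n, magnetization σ = magnetization τ → l σ = l τ) (t : ℕ) :
    tvDist (evolve (glauber n β) l t) (gibbs n β) =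
      tvDist (evolve (magChain n β) (magLaw l) t) (magLaw (gibbs n β)) := by
  rw [tvDist_magLaw (evolve_glauber_congr hn β hl t) fun _ _ h => gibbs_congr β h,
    magLaw_evolve hn]

theorem magIndex_eq_last_iff {n : ℕ} (σ : Config n) : magIndex σ = Fin.last n ↔ σ = 1 := by
  have h : magIndex σ = Fin.last n ↔ (Finset.univ.filter fun i => σ i = 1).card =
      (Finset.univ : Finset (Fin n)).card := by
    rw [Fin.ext_iff, magIndex, Fin.val_last, Finset.card_univ, Fintype.card_fin]
  rw [h, Finset.card_filter_eq_iff]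
  simp [funext_iff]

theorem allPlus_eq {n : ℕ} (σ : Config n) :
    allPlus n σ = if magIndex σ = Fin.last n then 1 else 0 := by
  simp only [magIndex_eq_last_iff, allPlus, Pi.single_apply]

theorem allPlus_congr {n : ℕ} {σ τ : Config n} (h : magnetization σ = magnetization τ) :
    allPlus n σ = allPlus n τ := by
  rw [allPlus_eq, allPlus_eq, (magIndex_eq_iff σ τ).2 h]

theorem magLaw_allPlus (n : ℕ) : magLaw (allPlus n) = magTop n := by
  ext j
  have h1 : magIndex (1 : Config n) = Fin.last n := (magIndex_eq_last_iff _).2 rfl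
  rw [magLaw, Finset.sum_filter, magTop, Pi.single_apply, Finset.sum_eq_single 1]
  · simp [allPlus, h1, eq_comm]
  · intro σ _ hσ
    simp [allPlus, hσ]
  · exact fun h => absurd (Finset.mem_univ _) h

/-- Powers of the magnetization chain act on functions through the birth-and-death operator. -/
theorem magChain_pow_mulVec {n : ℕ} (hn : 1 ≤ n) (β : ℝ) (g : ℕ → ℝ) (t : ℕ) :
    (magChain n β ^ t *ᵥ fun j => g j) =
      fun i : Fin (n + 1) => (bdOp (birthRate n β) (deathRate n β) ^ t) g i := by
  induction t with
  | zero => simp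
  | succ t ih =>
    rw [pow_succ', ← Matrix.mulVec_mulVec, ih, bdOp_pow_succ_apply']
    ext i
    exact magChain_mulVec hn β _ i

theorem evolve_dotProduct {n : ℕ} (hn : 1 ≤ n) (β : ℝ) (μ : Fin (n + 1) → ℝ) (g : ℕ → ℝ)
    (t : ℕ) : ∑ j, evolve (magChain n β) μ t j * g j =
      ∑ j : Fin (n + 1), μ j * (bdOp (birthRate n β) (deathRate n β) ^ t) g j := by
  change (μ ᵥ* magChain n β ^ t) ⬝ᵥ (fun j : Fin (n + 1) => g j) = _
  rw [← Matrix.dotProduct_mulVec, magChain_pow_mulVec hn]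
  rfl

/-! ### A lower bound for the mean magnetization -/

/-- The generator inequality for the cubic in scaled variables: m = k/n, e = 1/n, b = 1-β, d = p-q,
w = p+q. The choice Ab = 3 makes the m³ terms cancel, since -6 + 3Ab - Ab = 0; the coefficient 2 +
6A pays for the errors of order e, because m - Am³ ≥ m/2. -/
theorem drift_cubic_nonneg {b A m e d w : ℝ} (hA : 0 < A) (hAb : A * b = 3)
    (hm : 0 ≤ m) (hAm : A * m ^ 2 ≤ 1 / 2) (he : 0 ≤ e) (heA : 6 * A * e ≤ b)
    (hd : -b * m - 6 * m ^ 3 - m * e ≤ d) (hd0 : d ≤ 0) (hw : w ≤ 1) :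
    0 ≤ d * (1 - 3 * A * m ^ 2 - A * e ^ 2) - 3 * A * m * e * w +
      (b + (2 + 6 * A) * e) * (m - A * m ^ 3) := by
  have hb : 0 < b := pos_of_mul_pos_right (by linarith) hA.le
  have hme : 0 ≤ m * e := mul_nonneg hm he
  have h1 : 3 * A * m * e * w ≤ 3 * A * m * e :=
    mul_le_of_le_one_right (by positivity) hw
  have h2 : m / 2 ≤ m - A * m ^ 3 := by nlinarith [mul_le_mul_of_nonneg_left hAm hm]
  rcases le_total 0 (1 - 3 * A * m ^ 2 - A * e ^ 2) with hv | hv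
  · have h3 := mul_le_mul_of_nonneg_right hd hv
    have h4 : 0 ≤ A * m ^ 2 := by positivity
    have h5 : 0 ≤ A * e ^ 2 := by positivity
    have h6 : (6 * m ^ 3 + m * e) * (1 - 3 * A * m ^ 2 - A * e ^ 2) ≤ 6 * m ^ 3 + m * e :=
      mul_le_of_le_one_right (by positivity) (by linarith)
    have h7 : 0 ≤ b * m * (A * e ^ 2) := by positivity
    have h8 : (b * m) * (3 * A * m ^ 2) = 9 * m ^ 3 := by
      linear_combination (3 * m ^ 3) * hAb
    have h9 : b * (A * m ^ 3) = 3 * m ^ 3 := by linear_combination (m ^ 3) * hAb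
    have h10 := mul_le_mul_of_nonneg_left h2 (by positivity : 0 ≤ (2 + 6 * A) * e)
    nlinarith
  · have h3 := mul_nonneg_of_nonpos_of_nonpos hd0 hv
    have h4 := mul_le_mul_of_nonneg_left h2 hb.le
    have h5 : 0 ≤ (2 + 6 * A) * e * (m - A * m ^ 3) :=
      mul_nonneg (by positivity) (by linarith)
    have h6 := mul_le_mul_of_nonneg_right heA hm
    linarith

/-- A cubic test function, almost an eigenfunction of the chain for small positive
magnetizations. -/
def cubic (n : ℕ) (A k : ℝ) : ℝ := k - A * k ^ 3 / (n : ℝ) ^ 2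

theorem mul_cubic_le {n : ℕ} {β A k : ℝ} (hn : 1 ≤ n) (hβ₀ : 0 ≤ β) (hβ₁ : β < 1)
    (hA : 0 < A) (hAb : A * (1 - β) = 3) (hAn : 6 * A / n ≤ 1 - β) (hk : 1 / 2 ≤ k)
    (hAk : A * (k / n) ^ 2 ≤ 1 / 2) (hpq : upRate n β k + downRate n β k ≤ 1) :
    (1 - (1 - β) / n - (2 + 6 * A) / (n : ℝ) ^ 2) * cubic n A k ≤
      cubic n A k + upRate n β k * (cubic n A (k + 1) - cubic n A k) +
        downRate n β k * (cubic n A (k - 1) - cubic n A k) := by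
  have hn' : (0 : ℝ) < n := by positivity
  have hd := drift_ge hn hβ₀ hβ₁.le hk
  have hd0 : upRate n β k - downRate n β k ≤ 0 := by
    refine (drift_le hn hβ₀ hk).trans (neg_nonpos.2 ?_)
    exact mul_nonneg (div_nonneg (by linarith) hn'.le) (by linarith)
  have := drift_cubic_nonneg (e := 1 / n) hA hAb (by positivity : 0 ≤ k / n) hAk (by positivity)
    (by rwa [mul_one_div]) (by rwa [mul_one_div]) hd0 hpq
  rw [← sub_nonneg]
  refine this.trans (le_of_eq ?_)
  simp only [cubic]
  field_simp
  ring

/-- The running maximum of the positive part of the cubic test function. -/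
def runningCubic (n : ℕ) (A : ℝ) : ℕ → ℝ :=
  partialSups fun j : ℕ => if (j : ℝ) ≤ (n : ℝ) / 2 then 0 else cubic n A ((j : ℝ) - (n : ℝ) / 2)

theorem le_runningCubic (n : ℕ) (A : ℝ) {i j : ℕ} (hij : i ≤ j) :
    (if (i : ℝ) ≤ (n : ℝ) / 2 then 0 else cubic n A ((i : ℝ) - (n : ℝ) / 2)) ≤
      runningCubic n A j :=
  le_partialSups_of_le
    (fun j : ℕ => if (j : ℝ) ≤ (n : ℝ) / 2 then 0 else cubic n A ((j : ℝ) - (n : ℝ) / 2)) hij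

theorem runningCubic_nonneg (n : ℕ) (A : ℝ) (j : ℕ) : 0 ≤ runningCubic n A j := by
  have := le_runningCubic n A (Nat.zero_le j)
  rwa [if_pos (by push_cast; positivity)] at this

theorem runningCubic_succ (n : ℕ) (A : ℝ) (j : ℕ) : runningCubic n A (j + 1) =
    max (runningCubic n A j) (if ((j + 1 : ℕ) : ℝ) ≤ (n : ℝ) / 2 then 0
      else cubic n A (((j + 1 : ℕ) : ℝ) - (n : ℝ) / 2)) := by
  rw [runningCubic, partialSups_add_one]

theorem runningCubic_le (n : ℕ) {A : ℝ} (hA : 0 ≤ A) (j : ℕ) :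
    runningCubic n A j ≤ max ((j : ℝ) - (n : ℝ) / 2) 0 := by
  refine partialSups_le _ _ _ fun i hi => ?_
  split_ifs with h
  · exact le_max_right _ _
  · have hi' : (i : ℝ) ≤ j := by exact_mod_cast hi
    have : 0 ≤ A * ((i : ℝ) - (n : ℝ) / 2) ^ 3 / (n : ℝ) ^ 2 := by
      have : 0 ≤ (i : ℝ) - (n : ℝ) / 2 := by linarith
      positivity
    refine le_max_of_le_left ?_
    rw [cubic]
    linarith

theorem mul_runningCubic_le {n : ℕ} {β A : ℝ} (hn : 1 ≤ n) (hβ₀ : 0 ≤ β) (hβ₁ : β < 1)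
    (hA : 0 < A) (hAb : A * (1 - β) = 3) (hAn : 6 * A / n ≤ 1 - β) (j : ℕ) (hj : j ≤ n) :
    (1 - (1 - β) / n - (2 + 6 * A) / (n : ℝ) ^ 2) * runningCubic n A j ≤
      bdOp (birthRate n β) (deathRate n β) (runningCubic n A) j := by
  have hn' : (0 : ℝ) < n := by positivity
  have hM := isMonotoneRates hn β
  have hmono : ∀ i, runningCubic n A i ≤ runningCubic n A (i + 1) := fun i => by
    rw [runningCubic_succ]; exact le_max_left _ _
  have hp := hM.p_nonneg j hj
  have hq := hM.q_nonneg j hj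
  have hr : (1 - (1 - β) / n - (2 + 6 * A) / (n : ℝ) ^ 2) * runningCubic n A j ≤
      runningCubic n A j := by
    refine mul_le_of_le_one_left (runningCubic_nonneg n A j) ?_
    have h1 : 0 ≤ (1 - β) / n := div_nonneg (by linarith) hn'.le
    have h2 : 0 ≤ (2 + 6 * A) / (n : ℝ) ^ 2 := by positivity
    linarith
  have hup := mul_nonneg hp (sub_nonneg.2 (hmono j))
  rw [bdOp_apply]
  rcases j with _ | j
  · rw [hM.q_zero]
    linarith
  rw [Nat.add_sub_cancel]
  -- Without a new record the function is flat below and nondecreasing above, so the chain does not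
  -- decrease it. At a new record it equals the cubic, and at both neighbours it dominates the
  -- cubic.
  rcases le_or_gt (if ((j + 1 : ℕ) : ℝ) ≤ (n : ℝ) / 2 then 0
      else cubic n A (((j + 1 : ℕ) : ℝ) - (n : ℝ) / 2)) (runningCubic n A j) with h | h
  · have e : runningCubic n A (j + 1) = runningCubic n A j := by
      rw [runningCubic_succ, max_eq_left h]
    rw [← e, sub_self, mul_zero, add_zero]
    linarith
  · have e : runningCubic n A (j + 1) = (if ((j + 1 : ℕ) : ℝ) ≤ (n : ℝ) / 2 then 0
      else cubic n A (((j + 1 : ℕ) : ℝ) - (n : ℝ) / 2)) := by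
      rw [runningCubic_succ, max_eq_right h.le]
    by_cases hj2 : ((j + 1 : ℕ) : ℝ) ≤ (n : ℝ) / 2
    · rw [if_pos hj2] at h
      exact absurd h (not_lt.2 (runningCubic_nonneg n A j))
    rw [if_neg hj2] at e h
    set k := ((j + 1 : ℕ) : ℝ) - (n : ℝ) / 2 with hk
    have hk2 : 1 / 2 ≤ k := by
      have : (n : ℝ) + 1 ≤ 2 * ((j + 1 : ℕ) : ℝ) := by
        have h' : (n : ℝ) < 2 * ((j + 1 : ℕ) : ℝ) := by linarith
        have : n < 2 * (j + 1) := by exact_mod_cast h'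
        exact_mod_cast this
      linarith
    have hk3 : k ≤ n / 2 := by
      have : ((j + 1 : ℕ) : ℝ) ≤ n := by exact_mod_cast hj
      linarith
    have hdown : cubic n A (k - 1) ≤ runningCubic n A j := by
      have hk' : k - 1 = (j : ℝ) - (n : ℝ) / 2 := by rw [hk]; push_cast; ring
      by_cases hj3 : (j : ℝ) ≤ (n : ℝ) / 2
      · refine le_trans ?_ (runningCubic_nonneg n A j)
        have h1 : cubic n A (k - 1) = -((1 - k) * (1 - A * (k - 1) ^ 2 / (n : ℝ) ^ 2)) := by
          rw [cubic]; ring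
        rw [h1, neg_nonpos]
        refine mul_nonneg (by linarith) (sub_nonneg.2 ?_)
        rw [div_le_one (by positivity)]
        have h2 : (k - 1) ^ 2 ≤ 1 := by nlinarith
        rw [div_le_iff₀ hn'] at hAn
        have hn1 : (1 : ℝ) ≤ n := by exact_mod_cast hn
        have h3 := mul_le_mul_of_nonneg_left h2 hA.le
        nlinarith
      · have := le_runningCubic n A (le_refl j)
        rwa [if_neg hj3, ← hk'] at this
    have hup' : cubic n A (k + 1) ≤ runningCubic n A (j + 1 + 1) := by
      have := le_runningCubic n A (le_refl (j + 1 + 1))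
      have hk' : ((j + 1 + 1 : ℕ) : ℝ) - (n : ℝ) / 2 = k + 1 := by rw [hk]; push_cast; ring
      rwa [if_neg (by linarith), hk'] at this
    -- A record means that the cubic is still increasing here, which confines k to the range where
    -- the cubic inequality holds.
    have hAk : A * (k / n) ^ 2 ≤ 1 / 2 := by
      have h1 : cubic n A (k - 1) < cubic n A k := hdown.trans_lt h
      have h2 : cubic n A k - cubic n A (k - 1) =
          1 - 3 * (A * (k / n) ^ 2) + 3 * (A / n) * (k / n) - A / (n : ℝ) ^ 2 := by
        rw [cubic, cubic]; field_simp; ring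
      have h3 : k / n ≤ 1 / 2 := by rw [div_le_iff₀ hn']; linarith
      have h4 : 0 ≤ A / (n : ℝ) ^ 2 := by positivity
      have h5 : A / n ≤ 1 / 6 := by
        have : 6 * A / n = 6 * (A / n) := by ring
        linarith
      have h6 : 0 ≤ k / n := by positivity
      have h7 := mul_le_mul h5 h3 h6 (by norm_num)
      linarith
    have hpq : upRate n β k + downRate n β k ≤ 1 := hM.add_le_one (j + 1) hj
    have key := mul_cubic_le hn hβ₀ hβ₁ hA hAb hAn hk2 hAk hpq
    rw [e]
    have h1 := mul_le_mul_of_nonneg_left (sub_le_sub_right hup' (cubic n A k)) hp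
    have h2 := mul_le_mul_of_nonneg_left (sub_le_sub_right hdown (cubic n A k)) hq
    have e1 : birthRate n β (j + 1) = upRate n β k := rfl
    have e2 : deathRate n β (j + 1) = downRate n β k := rfl
    rw [e1] at h1 ⊢
    rw [e2] at h2 ⊢
    linarith

/-- The cubic itself may be negative at k = n/2, so the running maximum is tested near k = n/(2A);
rounding down costs at most half of k. -/
theorem runningCubic_top_ge {n : ℕ} {A : ℝ} (hA : 1 ≤ A) (hAn : 4 * A ≤ n) :
    (n : ℝ) / (8 * A) ≤ runningCubic n A n := by
  have hn' : (0 : ℝ) < n := by linarith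
  set x : ℝ := n / 2 + n / (2 * A)
  have hx : x ≤ n := by
    have : (n : ℝ) / (2 * A) ≤ n / 2 := by
      apply div_le_div_of_nonneg_left <;> linarith
    simp only [x]
    linarith
  have hx0 : 0 ≤ x := by positivity
  have h1 := Nat.floor_le hx0
  have h2 := Nat.lt_floor_add_one x
  have hjn : ⌊x⌋₊ ≤ n := by
    have : (⌊x⌋₊ : ℝ) ≤ n := h1.trans hx
    exact_mod_cast this
  have h3 : 2 ≤ (n : ℝ) / (2 * A) := by rw [le_div_iff₀ (by linarith)]; linarith
  set k : ℝ := (⌊x⌋₊ : ℝ) - n / 2 with hk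
  have hk1 : (n : ℝ) / (2 * A) / 2 ≤ k := by
    simp only [x] at h2; linarith
  have hk2 : k ≤ n / (2 * A) := by
    simp only [x] at h1; linarith
  have hk0 : 0 < k := by linarith
  have := le_runningCubic n A hjn
  rw [if_neg (by linarith), ← hk] at this
  refine le_trans ?_ this
  have e : cubic n A k = k * (1 - A * k ^ 2 / (n : ℝ) ^ 2) := by rw [cubic]; ring
  have h4 : A * k ^ 2 / (n : ℝ) ^ 2 ≤ 1 / 2 := by
    have h5 := mul_le_mul_of_nonneg_left (pow_le_pow_left₀ hk0.le hk2 2) (by linarith : 0 ≤ A)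
    rw [div_le_iff₀ (by positivity)]
    have h6 : A * ((n : ℝ) / (2 * A)) ^ 2 = (n : ℝ) ^ 2 / (4 * A) := by field_simp; ring
    have h7 : (n : ℝ) ^ 2 / (4 * A) ≤ (n : ℝ) ^ 2 / 4 := by
      apply div_le_div_of_nonneg_left <;> nlinarith
    nlinarith [sq_nonneg (n : ℝ)]
  rw [e]
  have h8 := mul_le_mul_of_nonneg_left (by linarith : 1 / 2 ≤ 1 - A * k ^ 2 / (n : ℝ) ^ 2) hk0.le
  have e2 : (n : ℝ) / (8 * A) = (n : ℝ) / (2 * A) / 2 * (1 / 2) := by field_simp; ring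
  rw [e2]
  linarith

/-- The mean positive magnetization decays at most at rate `(1 - β) / n + O(1 / n ^ 2)`. -/
theorem mean_posPart_ge {β : ℝ} (hβ₀ : 0 ≤ β) (hβ₁ : β < 1) :
    ∃ C c : ℝ, 0 < C ∧ 0 < c ∧ ∃ N : ℕ, ∀ n ≥ N, 1 ≤ n ∧ (1 - β) / n + C / (n : ℝ) ^ 2 ≤ 1 / 2 ∧
      ∀ t : ℕ, (1 - ((1 - β) / n + C / (n : ℝ) ^ 2)) ^ t * (c * n) ≤
        (bdOp (birthRate n β) (deathRate n β) ^ t)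
          (fun j => max ((j : ℝ) - (n : ℝ) / 2) 0) n := by
  have hb : 0 < 1 - β := by linarith
  set A : ℝ := 3 / (1 - β) with hAdef
  have hA1 : 3 ≤ A := by rw [hAdef, le_div_iff₀ hb]; linarith
  have hA : 0 < A := by linarith
  have hAb : A * (1 - β) = 3 := by rw [hAdef]; field_simp
  refine ⟨2 + 6 * A, 1 / (8 * A), by positivity, by positivity, ⌈6 * A ^ 2⌉₊, fun n hn => ?_⟩
  have hn2 : 6 * A ^ 2 ≤ n := (Nat.le_ceil _).trans (by exact_mod_cast hn)
  have hn3 : (54 : ℝ) ≤ n := by nlinarith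
  have hn1 : 1 ≤ n := by
    have : (1 : ℝ) ≤ n := by linarith
    exact_mod_cast this
  have hn' : (0 : ℝ) < n := by linarith
  have hAn : 6 * A / n ≤ 1 - β := by
    rw [div_le_iff₀ hn']
    nlinarith [mul_le_mul_of_nonneg_left hn2 hb.le]
  have hsmall : (1 - β) / n + (2 + 6 * A) / (n : ℝ) ^ 2 ≤ 1 / 2 := by
    have h1 : (1 - β) / n ≤ 1 / 4 := by rw [div_le_iff₀ hn']; linarith
    have h2 : (2 + 6 * A) / (n : ℝ) ^ 2 ≤ 1 / 4 := by
      rw [div_le_iff₀ (by positivity)]; nlinarith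
    linarith
  refine ⟨hn1, hsmall, fun t => ?_⟩
  have hM := isMonotoneRates hn1 β
  have h1 := hM.bdOp_pow_mono (fun j _ => runningCubic_le n hA.le j) t n le_rfl
  refine le_trans ?_ h1
  have h2 := hM.pow_mul_le_bdOp_pow (by linarith) (mul_runningCubic_le hn1 hβ₀ hβ₁ hA hAb hAn) t n
    le_rfl
  rw [sub_sub] at h2
  refine le_trans (mul_le_mul_of_nonneg_left ?_ (pow_nonneg (by linarith) t)) h2
  have := runningCubic_top_ge (n := n) (by linarith) (by nlinarith : 4 * A ≤ n)
  rwa [one_div_mul_eq_div]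

/-! ### Total variation distance -/

section TotalVariation

variable {Ω : Type} [Fintype Ω] {μ ν : Ω → ℝ}

theorem tvDist_le_one (hμ : μ ∈ stdSimplex ℝ Ω) (hν : ν ∈ stdSimplex ℝ Ω) : tvDist μ ν ≤ 1 := by
  have : ∑ x, |μ x - ν x| ≤ ∑ x, (μ x + ν x) := Finset.sum_le_sum fun x _ => by
    rw [abs_le]
    constructor <;> linarith [hμ.1 x, hν.1 x]
  rw [Finset.sum_add_distrib, hμ.2, hν.2] at this
  rw [tvDist]
  linarith

theorem tvDist_nonneg (μ ν : Ω → ℝ) : 0 ≤ tvDist μ ν :=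
  mul_nonneg (by norm_num) (Finset.sum_nonneg fun _ _ => abs_nonneg _)

theorem sum_sub_sum_le_tvDist (hμ : μ ∈ stdSimplex ℝ Ω) (hν : ν ∈ stdSimplex ℝ Ω) {f : Ω → ℝ}
    (hf0 : ∀ x, 0 ≤ f x) (hf1 : ∀ x, f x ≤ 1) :
    ∑ x, μ x * f x - ∑ x, ν x * f x ≤ tvDist μ ν := by
  -- The right-hand summand is the positive part of the difference; its linear half sums to zero.
  have h : ∑ x, (μ x * f x - ν x * f x) ≤ ∑ x, (1 / 2 * |μ x - ν x| + 1 / 2 * (μ x - ν x)) := by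
    refine Finset.sum_le_sum fun x _ => ?_
    rw [← sub_mul]
    rcases abs_cases (μ x - ν x) with ⟨h1, h2⟩ | ⟨h1, h2⟩ <;> rw [h1]
    · have := mul_le_of_le_one_right h2 (hf1 x)
      linarith
    · have := mul_nonpos_of_nonpos_of_nonneg h2.le (hf0 x)
      linarith
  rw [Finset.sum_sub_distrib, Finset.sum_add_distrib, ← Finset.mul_sum, ← Finset.mul_sum,
    Finset.sum_sub_distrib, hμ.2, hν.2] at h
  rw [tvDist]
  linarith

theorem exists_tvDist_eq (hμ : μ ∈ stdSimplex ℝ Ω) (hν : ν ∈ stdSimplex ℝ Ω) :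
    ∃ f : Ω → ℝ, (∀ x, 0 ≤ f x) ∧ (∀ x, f x ≤ 1) ∧
      tvDist μ ν = ∑ x, μ x * f x - ∑ x, ν x * f x := by
  refine ⟨fun x => if ν x ≤ μ x then 1 else 0, fun x => ?_, fun x => ?_, ?_⟩
  · dsimp only; split_ifs <;> norm_num
  · dsimp only; split_ifs <;> norm_num
  have h : ∑ x, (μ x * (if ν x ≤ μ x then 1 else 0) - ν x * (if ν x ≤ μ x then 1 else 0)) =
      ∑ x, (1 / 2 * |μ x - ν x| + 1 / 2 * (μ x - ν x)) := by
    refine Finset.sum_congr rfl fun x _ => ?_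
    split_ifs with hx
    · rw [abs_of_nonneg (sub_nonneg.2 hx)]; ring
    · rw [abs_of_neg (by linarith)]; ring
  rw [Finset.sum_sub_distrib, Finset.sum_add_distrib, ← Finset.mul_sum, ← Finset.mul_sum,
    Finset.sum_sub_distrib, hμ.2, hν.2] at h
  rw [h, tvDist]
  ring

end TotalVariation

/-! ### Convergence of the magnetization chain -/

theorem abs_sub_zero_le {n : ℕ} {g : ℕ → ℝ} {L : ℝ} (hg : ∀ j < n, |g (j + 1) - g j| ≤ L) :
    ∀ j ≤ n, |g j - g 0| ≤ j * L := by
  intro j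
  induction j with
  | zero => intro _; simp
  | succ j ih =>
    intro hj
    have h1 := ih (by omega)
    have h2 := hg j hj
    have h3 := abs_sub_le (g (j + 1)) (g j) (g 0)
    push_cast
    linarith

theorem sum_sub_sum_le {n : ℕ} {μ ν : Fin (n + 1) → ℝ} (hμ : μ ∈ stdSimplex ℝ (Fin (n + 1)))
    (hν : ν ∈ stdSimplex ℝ (Fin (n + 1))) {g : ℕ → ℝ} {L : ℝ} (hL : 0 ≤ L)
    (hg : ∀ j < n, |g (j + 1) - g j| ≤ L) :
    ∑ j, μ j * g j - ∑ j, ν j * g j ≤ 2 * n * L := by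
  have h : ∀ j : Fin (n + 1), |g j - g 0| ≤ n * L := fun j => by
    refine (abs_sub_zero_le hg j (by omega)).trans (mul_le_mul_of_nonneg_right ?_ hL)
    exact_mod_cast (by omega : (j : ℕ) ≤ n)
  have h1 : ∑ j, μ j * g j ≤ ∑ j, μ j * (g 0 + n * L) := Finset.sum_le_sum fun j _ =>
    mul_le_mul_of_nonneg_left (by linarith [(abs_le.1 (h j)).2]) (hμ.1 j)
  have h2 : ∑ j, ν j * (g 0 - n * L) ≤ ∑ j, ν j * g j := Finset.sum_le_sum fun j _ =>
    mul_le_mul_of_nonneg_left (by linarith [(abs_le.1 (h j)).1]) (hν.1 j)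
  rw [← Finset.sum_mul, hμ.2] at h1
  rw [← Finset.sum_mul, hν.2] at h2
  linarith

theorem contraction_rate_le_one {n : ℕ} {β : ℝ} (hn : 1 ≤ n) (hβ₀ : 0 ≤ β) :
    (1 - β) / n ≤ 1 := by
  have : (1 : ℝ) ≤ n := by exact_mod_cast hn
  rw [div_le_one (by linarith)]
  linarith

theorem sum_evolve_sub_le {n : ℕ} {β : ℝ} (hn : 1 ≤ n) (hβ₀ : 0 ≤ β)
    {μ ν : Fin (n + 1) → ℝ} (hμ : μ ∈ stdSimplex ℝ (Fin (n + 1)))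
    (hν : ν ∈ stdSimplex ℝ (Fin (n + 1))) {g : ℕ → ℝ} {L : ℝ} (hL : 0 ≤ L)
    (hg : ∀ j < n, |g (j + 1) - g j| ≤ L) (t : ℕ) :
    ∑ j, evolve (magChain n β) μ t j * g j - ∑ j, evolve (magChain n β) ν t j * g j ≤
      2 * n * ((1 - (1 - β) / n) ^ t * L) := by
  have hρ := contraction_rate_le_one hn hβ₀
  rw [evolve_dotProduct hn, evolve_dotProduct hn]
  exact sum_sub_sum_le hμ hν (mul_nonneg (pow_nonneg (by linarith) t) hL)
    ((isMonotoneRates hn β).abs_bdOp_pow_sub_le hρ (rates_contract hn hβ₀) hL hg t)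

theorem evolve_of_stationary {Ω : Type} [Fintype Ω] [DecidableEq Ω] {P : Matrix Ω Ω ℝ}
    {π : Ω → ℝ} (h : π ᵥ* P = π) (t : ℕ) : evolve P π t = π := by
  induction t with
  | zero => simp [evolve]
  | succ t ih => rw [evolve_succ, ih, h]

theorem magLaw_gibbs_vecMul {n : ℕ} (hn : 1 ≤ n) (β : ℝ) :
    magLaw (gibbs n β) ᵥ* magChain n β = magLaw (gibbs n β) := by
  rw [← magLaw_vecMul hn, gibbs_vecMul_glauber hn]

/-- The indicator of a state has Lipschitz constant 1, and contraction drives the difference of its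
two stationary means to zero. -/
theorem le_of_stationary {n : ℕ} {β : ℝ} (hn : 1 ≤ n) (hβ₀ : 0 ≤ β) (hβ₁ : β < 1)
    {μ ν : Fin (n + 1) → ℝ} (hμ : μ ∈ stdSimplex ℝ (Fin (n + 1)))
    (hν : ν ∈ stdSimplex ℝ (Fin (n + 1))) (hμs : μ ᵥ* magChain n β = μ)
    (hνs : ν ᵥ* magChain n β = ν) (i : Fin (n + 1)) : μ i ≤ ν i := by
  have hρ := contraction_rate_le_one hn hβ₀
  have hρ0 : 0 < (1 - β) / n := div_pos (by linarith) (by positivity)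
  set g : ℕ → ℝ := fun k => if k = i then 1 else 0 with hgdef
  have hg : ∀ j < n, |g (j + 1) - g j| ≤ 1 := by
    intro j _
    simp only [hgdef]
    split_ifs <;> norm_num
  have hs : ∀ μ : Fin (n + 1) → ℝ, ∑ j, μ j * g j = μ i := fun μ => by
    simp [hgdef, ← Fin.ext_iff]
  have h : ∀ t : ℕ, μ i - ν i ≤ 2 * n * (1 - (1 - β) / n) ^ t := fun t => by
    have := sum_evolve_sub_le hn hβ₀ hμ hν zero_le_one hg t
    rwa [evolve_of_stationary hμs, evolve_of_stationary hνs, hs, hs, mul_one] at this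
  have hlim : Filter.Tendsto (fun t : ℕ => 2 * n * (1 - (1 - β) / n) ^ t) Filter.atTop
      (𝓝 (2 * n * 0)) :=
    (tendsto_pow_atTop_nhds_zero_of_lt_one (by linarith) (by linarith)).const_mul _
  have := ge_of_tendsto' hlim h
  linarith

theorem magChain_isUniqueStationary {n : ℕ} {β : ℝ} (hn : 1 ≤ n) (hβ₀ : 0 ≤ β) (hβ₁ : β < 1) :
    IsUniqueStationary (magChain n β) (magLaw (gibbs n β)) := by
  have hπ := magLaw_mem_stdSimplex (gibbs_mem_stdSimplex n β)
  have hs := magLaw_gibbs_vecMul hn β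
  refine ⟨hπ, fun ν hν => ⟨fun h => ?_, fun h => h ▸ hs⟩⟩
  ext i
  exact le_antisymm (le_of_stationary hn hβ₀ hβ₁ hν hπ h hs i)
    (le_of_stationary hn hβ₀ hβ₁ hπ hν hs h i)

theorem magTop_mem_stdSimplex (n : ℕ) : magTop n ∈ stdSimplex ℝ (Fin (n + 1)) := by
  rw [magTop]
  exact single_mem_stdSimplex ℝ _

theorem sum_evolve_magTop {n : ℕ} (hn : 1 ≤ n) (β : ℝ) (g : ℕ → ℝ) (t : ℕ) :
    ∑ j, evolve (magChain n β) (magTop n) t j * g j =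
      (bdOp (birthRate n β) (deathRate n β) ^ t) g n := by
  rw [evolve_dotProduct hn]
  simp [magTop, Pi.single_apply]

/-- Stationarity turns the one-step bound into S ≤ (1-2ρ)S + 1. -/
theorem stationary_sq_le {n : ℕ} {β : ℝ} (hn : 1 ≤ n) (hβ₀ : 0 ≤ β) (hβ₁ : β < 1) :
    ∑ j : Fin (n + 1), magLaw (gibbs n β) j * ((j : ℕ) - (n : ℝ) / 2) ^ 2 ≤
      n / (2 * (1 - β)) := by
  have hπ := magLaw_mem_stdSimplex (gibbs_mem_stdSimplex n β)
  have hM := isMonotoneRates hn β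
  have h1 := evolve_dotProduct hn β (magLaw (gibbs n β))
    (fun j : ℕ => ((j : ℝ) - (n : ℝ) / 2) ^ 2) 1
  rw [evolve_of_stationary (magLaw_gibbs_vecMul hn β), pow_one] at h1
  set S := ∑ j : Fin (n + 1), magLaw (gibbs n β) j * ((j : ℕ) - (n : ℝ) / 2) ^ 2 with hS
  have h2 : S ≤ ∑ j : Fin (n + 1), magLaw (gibbs n β) j *
      ((1 - 2 * ((1 - β) / n)) * ((j : ℕ) - (n : ℝ) / 2) ^ 2 + 1) := by
    rw [h1]
    exact Finset.sum_le_sum fun j _ => mul_le_mul_of_nonneg_left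
      (hM.bdOp_sq_le (fun i _ => drift_mul_le hn hβ₀ i) j (by omega)) (hπ.1 j)
  have h3 : ∑ j : Fin (n + 1), magLaw (gibbs n β) j *
      ((1 - 2 * ((1 - β) / n)) * ((j : ℕ) - (n : ℝ) / 2) ^ 2 + 1) =
      (1 - 2 * ((1 - β) / n)) * S + 1 := by
    simp only [mul_add, mul_one, Finset.sum_add_distrib]
    rw [hπ.2, hS, Finset.mul_sum]
    congr 1
    exact Finset.sum_congr rfl fun j _ => by ring
  rw [h3] at h2
  have hn' : (0 : ℝ) < n := by positivity
  have h4 : 2 * ((1 - β) / n) * S ≤ 1 := by linarith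
  rw [le_div_iff₀ (by linarith)]
  have h5 : 2 * ((1 - β) / n) * S = S * (2 * (1 - β)) / n := by ring
  rwa [h5, div_le_one hn'] at h4

/-! ### Lower bound for the distance to stationarity -/

/-- Chebyshev's inequality on both sides of the level m/2, where m is the mean positive part: the
evolved law has variance at most n/(1-β), the stationary second moment is at most n/(2(1-β)), and
each is multiplied by 4/m². -/
theorem tvDist_magChain_ge {n : ℕ} {β M : ℝ} (hn : 1 ≤ n) (hβ₀ : 0 ≤ β) (hβ₁ : β < 1) (t : ℕ)
    (hM0 : 0 < M) (hMt : M ≤ (bdOp (birthRate n β) (deathRate n β) ^ t)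
      (fun j => max ((j : ℝ) - (n : ℝ) / 2) 0) n) :
    1 - 6 * n / ((1 - β) * M ^ 2) ≤
      tvDist (evolve (magChain n β) (magTop n) t) (magLaw (gibbs n β)) := by
  have hn' : (0 : ℝ) < n := by positivity
  have hb : 0 < 1 - β := by linarith
  have hR := isMonotoneRates hn β
  have hπ := magLaw_mem_stdSimplex (gibbs_mem_stdSimplex n β)
  have hμ := evolve_mem_stdSimplex (magChain_mem_rowStochastic hn β) (magTop_mem_stdSimplex n) t
  set X : ℕ → ℝ := fun j => max ((j : ℝ) - (n : ℝ) / 2) 0 with hX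
  set m := (bdOp (birthRate n β) (deathRate n β) ^ t) X n with hm
  have hm0 : 0 < m := hM0.trans_le hMt
  set μ := evolve (magChain n β) (magTop n) t with hμdef
  set π := magLaw (gibbs n β) with hπdef
  have hXlip : ∀ j < n, |X (j + 1) - X j| ≤ 1 := fun j _ => by
    have h1 := abs_max_sub_max_le_abs (((j + 1 : ℕ) : ℝ) - (n : ℝ) / 2) ((j : ℝ) - (n : ℝ) / 2) 0
    refine h1.trans (le_of_eq ?_)
    push_cast
    have : (j : ℝ) + 1 - n / 2 - (j - n / 2) = 1 := by ring
    rw [this, abs_one]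
  have hV : ∑ j : Fin (n + 1), μ j * (X j - m) ^ 2 ≤ n / (1 - β) := by
    have h1 := hR.bdVar_le (div_pos hb hn') (contraction_rate_le_one hn hβ₀)
      (rates_contract hn hβ₀) t zero_le_one hXlip n le_rfl
    rw [bdVar, ← sum_evolve_magTop hn, ← hμdef, ← hm, one_pow, one_div_div] at h1
    have h2 : ∑ j, μ j * X j = m := sum_evolve_magTop hn β X t
    have h3 : ∑ j : Fin (n + 1), μ j * (X j - m) ^ 2 =
        ∑ j : Fin (n + 1), (μ j * X j ^ 2 - 2 * m * (μ j * X j) + m ^ 2 * μ j) :=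
      Finset.sum_congr rfl fun j _ => by ring
    rw [h3, Finset.sum_add_distrib, Finset.sum_sub_distrib, ← Finset.mul_sum, ← Finset.mul_sum,
      h2, hμ.2]
    linarith
  have hS := stationary_sq_le hn hβ₀ hβ₁
  rw [← hπdef] at hS
  set f : Fin (n + 1) → ℝ := fun j => if m / 2 < X j then 1 else 0 with hf
  have hf0 : ∀ j, 0 ≤ f j := fun j => by simp only [hf]; split_ifs <;> norm_num
  have hf1 : ∀ j, f j ≤ 1 := fun j => by simp only [hf]; split_ifs <;> norm_num
  have hfμ : ∀ j : Fin (n + 1), 1 - 4 / m ^ 2 * (X j - m) ^ 2 ≤ f j := fun j => by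
    have h0 : 0 ≤ 4 / m ^ 2 * (X j - m) ^ 2 := by positivity
    simp only [hf]
    split_ifs with h
    · linarith
    · have h1 : (m / 2) ^ 2 ≤ (X j - m) ^ 2 := by nlinarith
      have h2 := mul_le_mul_of_nonneg_left h1 (by positivity : 0 ≤ 4 / m ^ 2)
      have h3 : 4 / m ^ 2 * (m / 2) ^ 2 = 1 := by field_simp; norm_num
      linarith
  have hfπ : ∀ j : Fin (n + 1), f j ≤ 4 / m ^ 2 * ((j : ℕ) - (n : ℝ) / 2) ^ 2 := fun j => by
    simp only [hf]
    split_ifs with h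
    · have h0 : m / 2 < ((j : ℕ) : ℝ) - (n : ℝ) / 2 :=
        (lt_max_iff.1 h).resolve_right (by linarith)
      have h1 : (m / 2) ^ 2 ≤ (((j : ℕ) : ℝ) - (n : ℝ) / 2) ^ 2 :=
        pow_le_pow_left₀ (by linarith) h0.le 2
      have h2 := mul_le_mul_of_nonneg_left h1 (by positivity : 0 ≤ 4 / m ^ 2)
      have h3 : 4 / m ^ 2 * (m / 2) ^ 2 = 1 := by field_simp; norm_num
      linarith
    · positivity
  refine le_trans ?_ (sum_sub_sum_le_tvDist hμ hπ hf0 hf1)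
  have h1 : ∑ j : Fin (n + 1), μ j * (1 - 4 / m ^ 2 * (X j - m) ^ 2) ≤ ∑ j, μ j * f j :=
    Finset.sum_le_sum fun j _ => mul_le_mul_of_nonneg_left (hfμ j) (hμ.1 j)
  have h2 : ∑ j, π j * f j ≤
      ∑ j : Fin (n + 1), π j * (4 / m ^ 2 * ((j : ℕ) - (n : ℝ) / 2) ^ 2) :=
    Finset.sum_le_sum fun j _ => mul_le_mul_of_nonneg_left (hfπ j) (hπ.1 j)
  have h3 : ∑ j : Fin (n + 1), μ j * (1 - 4 / m ^ 2 * (X j - m) ^ 2) =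
      1 - 4 / m ^ 2 * ∑ j : Fin (n + 1), μ j * (X j - m) ^ 2 := by
    have h : (1 : ℝ) = ∑ j, μ j := hμ.2.symm
    conv_rhs => rw [h]
    rw [Finset.mul_sum, ← Finset.sum_sub_distrib]
    exact Finset.sum_congr rfl fun j _ => by ring
  have h4 : ∑ j : Fin (n + 1), π j * (4 / m ^ 2 * ((j : ℕ) - (n : ℝ) / 2) ^ 2) =
      4 / m ^ 2 * ∑ j : Fin (n + 1), π j * ((j : ℕ) - (n : ℝ) / 2) ^ 2 := by
    rw [Finset.mul_sum]
    exact Finset.sum_congr rfl fun j _ => by ring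
  have h5 := mul_le_mul_of_nonneg_left hV (by positivity : 0 ≤ 4 / m ^ 2)
  have h6 := mul_le_mul_of_nonneg_left hS (by positivity : 0 ≤ 4 / m ^ 2)
  have h7 : 4 / m ^ 2 * (n / (1 - β)) + 4 / m ^ 2 * (n / (2 * (1 - β))) =
      6 * n / ((1 - β) * m ^ 2) := by field_simp; norm_num
  have h8 : 6 * n / ((1 - β) * m ^ 2) ≤ 6 * n / ((1 - β) * M ^ 2) := by
    refine div_le_div_of_nonneg_left (by positivity) (by positivity) ?_
    exact mul_le_mul_of_nonneg_left (pow_le_pow_left₀ hM0.le hMt 2) hb.le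
  linarith

/-! ### Upper bound for the distance to stationarity -/

theorem exists_gradient_bound : ∃ D : ℝ, 0 < D ∧ ∀ (n : ℕ) (β : ℝ), 1 ≤ n → 0 ≤ β → β ≤ 1 →
    ∀ g : ℕ → ℝ, (∀ j ≤ n, 0 ≤ g j) → (∀ j ≤ n, g j ≤ 1) → ∀ j : ℕ, (j : ℝ) ≤ 3 / 4 * n →
    |(bdOp (birthRate n β) (deathRate n β) ^ (n - 1)) g (j + 1) -
      (bdOp (birthRate n β) (deathRate n β) ^ (n - 1)) g j| ≤ D / √n := by
  set c := Real.sigmoid (-4) with hc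
  have hc0 : 0 < c := Real.sigmoid_pos _
  refine ⟨√(16 * Real.exp (2 / c) / c ^ 3), by positivity, fun n β hn hβ₀ hβ₁ g hg0 hg1 j hj => ?_⟩
  have hn' : (0 : ℝ) < n := by positivity
  have hjn : j ≤ n := by
    have : (j : ℝ) ≤ n := by linarith
    exact_mod_cast this
  have h1 := (isMonotoneRates hn β).gradient_sq_le (one_le_gradFactor n)
    (birthRate_succ_le hn hβ₀ hβ₁) (hold_edge_le hn hβ₀ hβ₁) hc0.le (rates_hold hn hβ₀ hβ₁)
    (n - 1) g hg0 hg1 j hjn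
  -- Over n - 1 steps the factors 1 + 1/(cn) accumulate only to a constant.
  have h2 : (gradFactor n ^ 2) ^ (n - 1) ≤ Real.exp (2 / c) := by
    have h3 : gradFactor n ≤ Real.exp (1 / (c * n)) := by
      rw [gradFactor, add_comm]; exact Real.add_one_le_exp _
    have h0 : 0 ≤ gradFactor n := zero_le_one.trans (one_le_gradFactor n)
    calc (gradFactor n ^ 2) ^ (n - 1) ≤ (gradFactor n ^ 2) ^ n :=
          pow_le_pow_right₀ (one_le_pow₀ (one_le_gradFactor n)) (by omega)
      _ = gradFactor n ^ (2 * n) := by rw [pow_mul]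
      _ ≤ Real.exp (1 / (c * n)) ^ (2 * n) := pow_le_pow_left₀ h0 h3 _
      _ = Real.exp (2 / c) := by
          rw [← Real.exp_nat_mul]
          congr 1
          push_cast
          field_simp
  set d := |(bdOp (birthRate n β) (deathRate n β) ^ (n - 1)) g (j + 1) -
      (bdOp (birthRate n β) (deathRate n β) ^ (n - 1)) g j| with hd
  have hd0 : 0 ≤ d := abs_nonneg _
  have hcast : ((n - 1 : ℕ) : ℝ) + 1 = n := by
    rw [Nat.cast_sub hn]; push_cast; ring
  rw [hcast] at h1
  have h4 : c * n * (c / 4 * d) ^ 2 ≤ Real.exp (2 / c) := by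
    refine le_trans (mul_le_mul_of_nonneg_left (pow_le_pow_left₀ (by positivity) ?_ 2)
      (by positivity)) (h1.trans h2)
    exact mul_le_mul_of_nonneg_right (birthRate_ge hn hβ₀ hβ₁ j hj) hd0
  rw [← Real.sqrt_div (by positivity)]
  refine Real.le_sqrt_of_sq_le ?_
  rw [div_div, le_div_iff₀ (by positivity)]
  linarith

theorem exists_tvDist_magChain_le {β : ℝ} (hβ₀ : 0 ≤ β) (hβ₁ : β < 1) :
    ∃ D : ℝ, 0 < D ∧ ∀ n : ℕ, 2 ≤ n → ∀ s : ℕ,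
      tvDist (evolve (magChain n β) (magTop n) (s + (n - 1))) (magLaw (gibbs n β)) ≤
        D * (√n * (1 - (1 - β) / n) ^ s) + 4 * (√n * (1 - (1 - β) / n) ^ s) ^ 2 / n +
          16 / ((1 - β) * n) := by
  obtain ⟨D, hD0, hD⟩ := exists_gradient_bound
  refine ⟨2 * D, by positivity, fun n hn2 s => ?_⟩
  have hn : 1 ≤ n := by omega
  have hn' : (0 : ℝ) < n := by positivity
  have hn2' : (2 : ℝ) ≤ n := by exact_mod_cast hn2
  have hb : 0 < 1 - β := by linarith
  have hR := isMonotoneRates hn β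
  have hπ := magLaw_mem_stdSimplex (gibbs_mem_stdSimplex n β)
  have hrow := magChain_mem_rowStochastic hn β
  obtain ⟨f, hf0, hf1, hf⟩ := exists_tvDist_eq
    (evolve_mem_stdSimplex hrow (magTop_mem_stdSimplex n) (s + (n - 1))) hπ
  rw [hf]
  set g : ℕ → ℝ := fun k => if hk : k < n + 1 then f ⟨k, hk⟩ else 0 with hg
  have hgf : ∀ j : Fin (n + 1), f j = g j := fun j => by simp only [hg, j.2, dif_pos, Fin.eta]
  have hg0 : ∀ j ≤ n, 0 ≤ g j := fun j hj => by
    simp only [hg]; rw [dif_pos (by omega)]; exact hf0 _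
  have hg1 : ∀ j ≤ n, g j ≤ 1 := fun j hj => by
    simp only [hg]; rw [dif_pos (by omega)]; exact hf1 _
  simp only [hgf]
  set F := (bdOp (birthRate n β) (deathRate n β) ^ (n - 1)) g with hF
  have hF0 : ∀ j ≤ n, 0 ≤ F j := hR.const_le_bdOp_pow hg0 (n - 1)
  have hF1 : ∀ j ≤ n, F j ≤ 1 := hR.bdOp_pow_le_const hg1 (n - 1)
  set μ := evolve (magChain n β) (magTop n) s with hμdef
  set π := magLaw (gibbs n β) with hπdef
  have hμ : μ ∈ stdSimplex ℝ (Fin (n + 1)) :=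
    evolve_mem_stdSimplex hrow (magTop_mem_stdSimplex n) s
  have e1 : ∑ j, evolve (magChain n β) (magTop n) (s + (n - 1)) j * g j = ∑ j, μ j * F j := by
    -- The last n - 1 steps are moved onto the test function, the first `s` stay on the law.
    rw [hμdef, sum_evolve_magTop hn, sum_evolve_magTop hn, pow_add]; rfl
  have hπt := evolve_of_stationary (magLaw_gibbs_vecMul hn β)
  have e2 : ∑ j, π j * g j = ∑ j, π j * F j := by
    have := evolve_dotProduct hn β π g (n - 1)
    rwa [hπt] at this
  rw [e1, e2]
  set J := ⌊(3 / 4 * n : ℝ)⌋₊ with hJ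
  have hJ1 : (J : ℝ) ≤ 3 / 4 * n := Nat.floor_le (by positivity)
  have hJn : J ≤ n := by
    have : (J : ℝ) ≤ n := by linarith
    exact_mod_cast this
  -- The smoothed function is frozen above 3n/4, where no gradient bound is available.
  set G : ℕ → ℝ := fun k => F (min k J) with hG
  have hGlip : ∀ j < n, |G (j + 1) - G j| ≤ D / √n := by
    intro j _
    simp only [hG]
    rcases lt_or_ge j J with h | h
    · rw [min_eq_left (by omega), min_eq_left h.le]
      refine hD n β hn hβ₀ hβ₁.le g hg0 hg1 j (le_trans ?_ hJ1)
      exact_mod_cast h.le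
    · rw [min_eq_right (by omega), min_eq_right h, sub_self, abs_zero]
      positivity
  -- Above 3n/4 the magnetization exceeds n/4, so the right side is at least 1.
  have hFG : ∀ j ≤ n, |F j - G j| ≤ 16 / (n : ℝ) ^ 2 * ((j : ℝ) - (n : ℝ) / 2) ^ 2 := by
    intro j hj
    simp only [hG]
    rcases le_or_gt j J with h | h
    · rw [min_eq_left h, sub_self, abs_zero]; positivity
    · have h1 : |F j - F (min j J)| ≤ 1 := by
        rw [abs_le]
        constructor <;> linarith [hF0 j hj, hF1 j hj, hF0 (min j J) (by omega),
          hF1 (min j J) (by omega)]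
      have h2 : 3 / 4 * (n : ℝ) < j := (Nat.floor_lt (by positivity)).1 h
      have h3 : ((n : ℝ) / 4) ^ 2 ≤ ((j : ℝ) - (n : ℝ) / 2) ^ 2 :=
        pow_le_pow_left₀ (by positivity) (by linarith) 2
      have h4 := mul_le_mul_of_nonneg_left h3 (by positivity : 0 ≤ 16 / (n : ℝ) ^ 2)
      have h5 : 16 / (n : ℝ) ^ 2 * ((n : ℝ) / 4) ^ 2 = 1 := by field_simp; norm_num
      linarith
  have hdiff : ∀ ν : Fin (n + 1) → ℝ, ν ∈ stdSimplex ℝ (Fin (n + 1)) →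
      |∑ j, ν j * F j - ∑ j, ν j * G j| ≤
        16 / (n : ℝ) ^ 2 * ∑ j : Fin (n + 1), ν j * ((j : ℕ) - (n : ℝ) / 2) ^ 2 := by
    intro ν hν
    rw [← Finset.sum_sub_distrib, Finset.mul_sum]
    refine (Finset.abs_sum_le_sum_abs _ _).trans (Finset.sum_le_sum fun j _ => ?_)
    rw [← mul_sub, abs_mul, abs_of_nonneg (hν.1 j)]
    have := mul_le_mul_of_nonneg_left (hFG j (by omega)) (hν.1 j)
    linarith
  have h1 := (abs_le.1 (hdiff μ hμ)).2
  have h2 := (abs_le.1 (hdiff π hπ)).1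
  have h3 := stationary_sq_le hn hβ₀ hβ₁
  rw [← hπdef] at h3
  set ρ := (1 - β) / n with hρ
  have hρ0 : 0 < ρ := div_pos hb hn'
  have hρ1 : 2 * ρ ≤ 1 := by
    rw [hρ, ← mul_div_assoc, div_le_one hn']; linarith
  have h4 : ∑ j : Fin (n + 1), μ j * ((j : ℕ) - (n : ℝ) / 2) ^ 2 ≤
      ((1 - ρ) ^ s) ^ 2 * (n / 2) ^ 2 + n / (2 * (1 - β)) := by
    have h5 := hR.bdOp_pow_sq_le hρ0 hρ1 (fun j _ => drift_mul_le hn hβ₀ j) s n le_rfl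
    have h6 := sum_evolve_magTop hn β (fun j : ℕ => ((j : ℝ) - (n : ℝ) / 2) ^ 2) s
    rw [← hμdef] at h6
    rw [h6]
    refine h5.trans (add_le_add ?_ (le_of_eq ?_))
    · have e : (n : ℝ) - n / 2 = n / 2 := by ring
      rw [e, ← pow_mul, mul_comm s 2, pow_mul]
      exact mul_le_mul_of_nonneg_right
        (pow_le_pow_left₀ (by linarith) (by nlinarith [sq_nonneg ρ]) s) (by positivity)
    · rw [hρ]; field_simp
  have h5 := sum_evolve_sub_le hn hβ₀ (magTop_mem_stdSimplex n) hπ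
    (by positivity : 0 ≤ D / √n) hGlip s
  rw [hπt, ← hμdef, ← hρ] at h5
  have hsq : √(n : ℝ) ^ 2 = n := Real.sq_sqrt hn'.le
  have hsq0 : 0 < √(n : ℝ) := Real.sqrt_pos.2 hn'
  have e3 : 2 * n * ((1 - ρ) ^ s * (D / √n)) = 2 * D * (√n * (1 - ρ) ^ s) := by
    field_simp
    rw [hsq, mul_comm]
  have hc : (0 : ℝ) ≤ 16 / (n : ℝ) ^ 2 := by positivity
  have h6 := mul_le_mul_of_nonneg_left h4 hc
  have h7 := mul_le_mul_of_nonneg_left h3 hc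
  have e4 : 16 / (n : ℝ) ^ 2 * (((1 - ρ) ^ s) ^ 2 * (n / 2) ^ 2 + n / (2 * (1 - β))) +
      16 / (n : ℝ) ^ 2 * (n / (2 * (1 - β))) =
      4 * (√n * (1 - ρ) ^ s) ^ 2 / n + 16 / ((1 - β) * n) := by
    rw [mul_pow, hsq]
    field_simp
    ring
  linarith

/-! ### Cutoff -/

theorem tendsto_log_natCast_div : Filter.Tendsto (fun n : ℕ => Real.log n / n) Filter.atTop
    (𝓝 0) :=
  (Real.isLittleO_log_id_atTop.tendsto_div_nhds_zero).comp tendsto_natCast_atTop_atTop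

theorem eventually_le_log (x : ℝ) : ∀ᶠ n : ℕ in Filter.atTop, x ≤ Real.log n :=
  (Real.tendsto_log_atTop.comp tendsto_natCast_atTop_atTop).eventually_ge_atTop x

/-- For u of order 1/n, the quadratic error accumulated up to the cutoff time is O(log n / n). -/
theorem neg_add_two_mul_sq_le_log {u : ℝ} (hu1 : u ≤ 1 / 2) :
    -(u + 2 * u ^ 2) ≤ Real.log (1 - u) := by
  have h0 : 0 < 1 - u := by linarith
  refine le_trans ?_ (Real.one_sub_inv_le_log_of_pos h0)
  have h1 : 1 - (1 - u)⁻¹ = -(u / (1 - u)) := by field_simp; ring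
  rw [h1, neg_le_neg_iff, div_le_iff₀ h0]
  nlinarith [mul_nonneg (sq_nonneg u) (by linarith : 0 ≤ 1 - 2 * u)]

theorem toNat_floor_le {x y : ℝ} (hy : 0 ≤ y) (hxy : x ≤ y) : ((⌊x⌋.toNat : ℕ) : ℝ) ≤ y := by
  rcases le_total 0 ⌊x⌋ with h | h
  · have h1 : ((⌊x⌋.toNat : ℕ) : ℝ) = (⌊x⌋ : ℝ) := by
      exact_mod_cast congrArg (Int.cast : ℤ → ℝ) (Int.toNat_of_nonneg h)
    rw [h1]
    exact (Int.floor_le x).trans hxy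
  · rw [Int.toNat_of_nonpos h]
    simpa using hy

theorem sub_one_le_toNat_floor (x : ℝ) : x - 1 ≤ ((⌊x⌋.toNat : ℕ) : ℝ) := by
  have h1 : (⌊x⌋ : ℝ) ≤ ((⌊x⌋.toNat : ℕ) : ℝ) := by exact_mod_cast Int.self_le_toNat ⌊x⌋
  linarith [Int.lt_floor_add_one x]

theorem tvDist_before_cutoff {β : ℝ} (hβ₀ : 0 ≤ β) (hβ₁ : β < 1) :
    ∃ K : ℝ, ∀ θ : ℝ, 0 ≤ θ → ∀ᶠ n : ℕ in Filter.atTop,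
      1 - K * Real.exp (-(2 * (1 - β)) * θ) ≤
        tvDist (evolve (magChain n β) (magTop n)
          ⌊(cutoffTime β n : ℝ) - θ * ((n : ℤ) : ℝ)⌋.toNat) (magLaw (gibbs n β)) := by
  obtain ⟨C, c, hC, hc, N, hN⟩ := mean_posPart_ge hβ₀ hβ₁
  set b := 1 - β with hb_def
  have hb : 0 < b := by linarith
  refine ⟨6 * Real.exp 2 / (b * c ^ 2), fun θ hθ => ?_⟩
  -- Collects all terms of order 1/n² in u + 2u². The eventual bound on log n / n makes their total
  -- over the time span at most 1, and log n ≥ 2bθ makes the real time nonnegative, so that reading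
  -- negative times as 0 is harmless.
  set E := C + 2 * (b + C) ^ 2 with hE
  have hE0 : 0 < E := by positivity
  have hlog := tendsto_log_natCast_div.eventually
    (eventually_le_nhds (by positivity : (0 : ℝ) < 2 * b / E))
  filter_upwards [Filter.eventually_ge_atTop N, hlog, eventually_le_log (2 * b * θ)]
    with n hn hlogn hlogθ
  obtain ⟨hn1, hu1, hmean⟩ := hN n hn
  have hn' : (0 : ℝ) < n := by positivity
  have hn1' : (1 : ℝ) ≤ n := by exact_mod_cast hn1
  set u := b / n + C / (n : ℝ) ^ 2 with hu
  have hu0 : 0 ≤ u := by positivity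
  set t := ⌊(cutoffTime β n : ℝ) - θ * ((n : ℤ) : ℝ)⌋.toNat with ht
  have hlog0 : 0 ≤ Real.log n := Real.log_nonneg hn1'
  have hT : (t : ℝ) ≤ n * Real.log n / (2 * b) - θ * n := by
    refine toNat_floor_le ?_ ?_
    · rw [sub_nonneg, le_div_iff₀ (by positivity)]
      nlinarith
    · rw [Int.cast_natCast]
      exact sub_le_sub_right (Int.floor_le _) _
  have hu2 : u + 2 * u ^ 2 ≤ b / n + E / (n : ℝ) ^ 2 := by
    have h1 : u ≤ (b + C) / n := by
      rw [add_div, hu]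
      refine add_le_add le_rfl (div_le_div_of_nonneg_left hC.le hn' ?_)
      nlinarith
    have h2 := pow_le_pow_left₀ hu0 h1 2
    have h3 : b / n + E / (n : ℝ) ^ 2 = u + 2 * ((b + C) / n) ^ 2 := by
      rw [hu, hE]; field_simp; ring
    linarith
  have hexp : (t : ℝ) * (u + 2 * u ^ 2) ≤ Real.log n / 2 - θ * b + 1 := by
    have h1 := mul_le_mul_of_nonneg_left hu2 (Nat.cast_nonneg t : (0 : ℝ) ≤ t)
    have h2 := mul_le_mul_of_nonneg_right hT (by positivity : 0 ≤ b / n + E / (n : ℝ) ^ 2)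
    have h3 : (n * Real.log n / (2 * b) - θ * n) * (b / n + E / (n : ℝ) ^ 2) =
        Real.log n / 2 - θ * b + E / (2 * b) * (Real.log n / n) - θ * E / n := by
      field_simp
      ring
    have h4 := mul_le_mul_of_nonneg_left hlogn (by positivity : 0 ≤ E / (2 * b))
    have h5 : E / (2 * b) * (2 * b / E) = 1 := by field_simp
    have h6 : 0 ≤ θ * E / n := by positivity
    linarith
  have hpow : Real.exp (-(Real.log n / 2 - θ * b + 1)) ≤ (1 - u) ^ t := by
    have h0 : 0 < 1 - u := by linarith
    rw [← Real.exp_log (pow_pos h0 t), Real.log_pow]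
    refine Real.exp_le_exp.2 ?_
    have := mul_le_mul_of_nonneg_left (neg_add_two_mul_sq_le_log hu1)
      (Nat.cast_nonneg t : (0 : ℝ) ≤ t)
    linarith
  have hM := (mul_le_mul_of_nonneg_right hpow (by positivity : 0 ≤ c * n)).trans (hmean t)
  -- The lower bound for the mean is (c/e)√n exp(bθ), so the powers of n cancel.
  refine le_trans (le_of_eq ?_) (tvDist_magChain_ge hn1 hβ₀ hβ₁ t (by positivity) hM)
  have e1 : Real.exp (-(Real.log n / 2 - θ * b + 1)) ^ 2 =
      Real.exp (2 * b * θ) / (n * Real.exp 2) := by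
    rw [← Real.exp_nat_mul, eq_div_iff (by positivity)]
    conv_lhs => rw [← Real.exp_log hn']
    rw [Real.log_exp, ← Real.exp_add, ← Real.exp_add]
    congr 1
    push_cast
    ring
  rw [mul_pow, e1, ← hb_def, neg_mul, Real.exp_neg]
  congr 1
  field_simp

theorem tvDist_after_cutoff {β : ℝ} (hβ₀ : 0 ≤ β) (hβ₁ : β < 1) :
    ∃ K : ℝ, ∀ θ : ℝ, 0 ≤ θ → ∀ᶠ n : ℕ in Filter.atTop,
      tvDist (evolve (magChain n β) (magTop n)
          ⌊(cutoffTime β n : ℝ) + θ * ((n : ℤ) : ℝ)⌋.toNat) (magLaw (gibbs n β)) ≤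
        K * Real.exp (-(1 - β) * θ) := by
  obtain ⟨D, hD0, hD⟩ := exists_tvDist_magChain_le hβ₀ hβ₁
  set b := 1 - β with hb_def
  have hb : 0 < b := by linarith
  -- The factor exp 3 absorbs the smoothing steps and the roundings; the summand 1 absorbs the two
  -- error terms of order 1/n, which are eventually below exp(-bθ).
  refine ⟨D * Real.exp 3 + 1, fun θ hθ => ?_⟩
  have hsmall : ∀ᶠ n : ℕ in Filter.atTop, (4 * Real.exp 3 ^ 2 + 16 / b) / (n : ℝ) ≤
      Real.exp (-b * θ) :=
    (tendsto_const_div_atTop_nhds_zero_nat _).eventually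
      (eventually_le_nhds (Real.exp_pos _))
  filter_upwards [Filter.eventually_ge_atTop 2, hsmall, eventually_le_log (4 * b)]
    with n hn2 hn3 hlog
  have hn2' : (2 : ℝ) ≤ n := by exact_mod_cast hn2
  have hn' : (0 : ℝ) < n := by linarith
  set t := ⌊(cutoffTime β n : ℝ) + θ * ((n : ℤ) : ℝ)⌋.toNat with ht
  have hT : n * Real.log n / (2 * b) + θ * n - 2 ≤ t := by
    refine le_trans ?_ (sub_one_le_toNat_floor _)
    have := Int.lt_floor_add_one (n * Real.log n / (2 * (1 - β)))
    rw [← hb_def] at this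
    rw [Int.cast_natCast, cutoffTime, ← hb_def]
    linarith
  have h1 : 2 * (n : ℝ) ≤ n * Real.log n / (2 * b) := by
    rw [le_div_iff₀ (by positivity)]
    nlinarith
  have htn : n - 1 ≤ t := by
    have : (n : ℝ) ≤ t := by nlinarith [mul_nonneg hθ hn'.le]
    have : n ≤ t := by exact_mod_cast this
    omega
  obtain ⟨s, hs⟩ := Nat.exists_eq_add_of_le' htn
  have hs' : n * Real.log n / (2 * b) + θ * n - 2 - n ≤ s := by
    have h2 : t ≤ s + n := by omega
    have h3 : (t : ℝ) ≤ s + n := by exact_mod_cast h2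
    linarith
  have hy : √n * (1 - b / n) ^ s ≤ Real.exp 3 * Real.exp (-b * θ) := by
    have h2 : (1 - b / n) ^ s ≤ Real.exp (-(s * (b / n))) := by
      have h3 : 0 ≤ 1 - b / n := by
        rw [sub_nonneg, div_le_one hn']; linarith
      refine (pow_le_pow_left₀ h3 (Real.one_sub_le_exp_neg _) s).trans (le_of_eq ?_)
      rw [← Real.exp_nat_mul]
      congr 1
      ring
    have h4 : √(n : ℝ) = Real.exp (Real.log n / 2) := by
      rw [Real.exp_half, Real.exp_log hn']
    refine (mul_le_mul_of_nonneg_left h2 (Real.sqrt_nonneg _)).trans ?_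
    rw [h4, ← Real.exp_add, ← Real.exp_add]
    refine Real.exp_le_exp.2 ?_
    have h5 := mul_le_mul_of_nonneg_right hs' (by positivity : 0 ≤ b / n)
    have h6 : (n * Real.log n / (2 * b) + θ * n - 2 - n) * (b / n) =
        Real.log n / 2 + b * θ - b - 2 * b / n := by
      field_simp
      ring
    have h7 : 2 * b / n ≤ 1 := by rw [div_le_one hn']; linarith
    linarith
  have hy0 : 0 ≤ √n * (1 - b / n) ^ s := by
    have h3 : 0 ≤ 1 - b / n := by
      rw [sub_nonneg, div_le_one hn']; linarith
    positivity
  have hy1 : √n * (1 - b / n) ^ s ≤ Real.exp 3 := by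
    refine hy.trans (mul_le_of_le_one_right (Real.exp_pos _).le (Real.exp_le_one_iff.2 ?_))
    have := mul_nonneg hb.le hθ
    linarith
  have hmain := hD n hn2 s
  rw [← hs] at hmain
  refine hmain.trans ?_
  have h8 := mul_le_mul_of_nonneg_left hy hD0.le
  have h9 : 4 * (√n * (1 - b / n) ^ s) ^ 2 / n ≤ 4 * Real.exp 3 ^ 2 / n :=
    div_le_div_of_nonneg_right
      (mul_le_mul_of_nonneg_left (pow_le_pow_left₀ hy0 hy1 2) (by norm_num)) hn'.le
  have h10 : (4 * Real.exp 3 ^ 2 + 16 / b) / (n : ℝ) = 4 * Real.exp 3 ^ 2 / n + 16 / (b * n) := by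
    field_simp
  linarith

theorem tendsto_exp_neg_mul {a : ℝ} (ha : 0 < a) (K : ℝ) :
    Filter.Tendsto (fun θ : ℝ => K * Real.exp (-a * θ)) Filter.atTop (𝓝 0) := by
  have h : Filter.Tendsto (fun θ : ℝ => -a * θ) Filter.atTop Filter.atBot :=
    Filter.tendsto_id.const_mul_atTop_of_neg (by linarith)
  simpa using (Real.tendsto_exp_atBot.comp h).const_mul K

theorem tendsto_window {β : ℝ} (hβ₁ : β < 1) :
    Filter.Tendsto (fun n : ℕ => (((n : ℤ)) : ℝ) / (cutoffTime β n : ℝ)) Filter.atTop (𝓝 0) := by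
  have hb : 0 < 1 - β := by linarith
  have h1 : Filter.Tendsto (fun n : ℕ => Real.log n / (2 * (1 - β)) - 1) Filter.atTop
      Filter.atTop :=
    Filter.tendsto_atTop_add_const_right _ _
      ((Real.tendsto_log_atTop.comp tendsto_natCast_atTop_atTop).atTop_div_const (by positivity))
  have h2 := h1.inv_tendsto_atTop
  refine tendsto_of_tendsto_of_tendsto_of_le_of_le' tendsto_const_nhds h2 ?_ ?_
  · filter_upwards [Filter.eventually_ge_atTop 1] with n hn
    have hn1 : (1 : ℝ) ≤ n := by exact_mod_cast hn
    have h3 : 0 ≤ cutoffTime β n :=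
      Int.floor_nonneg.2 (div_nonneg (mul_nonneg (by linarith) (Real.log_nonneg hn1)) (by linarith))
    have h4 : (0 : ℝ) ≤ cutoffTime β n := by exact_mod_cast h3
    positivity
  · filter_upwards [Filter.eventually_ge_atTop 1, h1.eventually_gt_atTop 0] with n hn hlog
    have hn1 : (1 : ℝ) ≤ n := by exact_mod_cast hn
    have h3 : (n : ℝ) * (Real.log n / (2 * (1 - β)) - 1) ≤ cutoffTime β n := by
      have := Int.lt_floor_add_one (n * Real.log n / (2 * (1 - β)))
      have h4 : (n : ℝ) * (Real.log n / (2 * (1 - β)) - 1) =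
          n * Real.log n / (2 * (1 - β)) - n := by ring
      rw [h4, cutoffTime]
      linarith
    have h5 : 0 < (n : ℝ) * (Real.log n / (2 * (1 - β)) - 1) := mul_pos (by linarith) hlog
    simp only [Pi.inv_apply, Int.cast_natCast]
    rw [div_le_iff₀ (by linarith), inv_mul_eq_div, le_div_iff₀ hlog]
    exact h3

theorem magChain_exhibitsCutoff {β : ℝ} (hβ₀ : 0 ≤ β) (hβ₁ : β < 1) :
    ExhibitsCutoff (fun n => magChain n β) magTop (fun n => magLaw (gibbs n β))
      (cutoffTime β) (fun n => (n : ℤ)) where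
  window := tendsto_window hβ₁
  before := by
    obtain ⟨K, hK⟩ := tvDist_before_cutoff hβ₀ hβ₁
    have hle : ∀ θ : ℝ, ∀ᶠ n : ℕ in Filter.atTop,
        tvDist (evolve (magChain n β) (magTop n)
          ⌊(cutoffTime β n : ℝ) - θ * ((n : ℤ) : ℝ)⌋.toNat) (magLaw (gibbs n β)) ≤ 1 := fun θ => by
      filter_upwards [Filter.eventually_ge_atTop 1] with n hn
      exact tvDist_le_one (evolve_mem_stdSimplex (magChain_mem_rowStochastic hn β)
        (magTop_mem_stdSimplex n) _) (magLaw_mem_stdSimplex (gibbs_mem_stdSimplex n β))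
    have hlim : Filter.Tendsto (fun θ : ℝ => 1 - K * Real.exp (-(2 * (1 - β)) * θ)) Filter.atTop
        (𝓝 1) := by
      simpa using (tendsto_exp_neg_mul (by linarith : 0 < 2 * (1 - β)) K).const_sub 1
    refine tendsto_of_tendsto_of_tendsto_of_le_of_le' hlim tendsto_const_nhds ?_ ?_
    · filter_upwards [Filter.eventually_ge_atTop 0] with θ hθ
      exact Filter.le_liminf_of_le
        (Filter.isBoundedUnder_of_eventually_le (hle θ)).isCoboundedUnder_ge (hK θ hθ)
    · refine Filter.Eventually.of_forall fun θ => ?_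
      refine Filter.liminf_le_of_frequently_le (hle θ).frequently
        (Filter.isBoundedUnder_of_eventually_ge (Filter.Eventually.of_forall fun n =>
          tvDist_nonneg _ _))
  after := by
    obtain ⟨K, hK⟩ := tvDist_after_cutoff hβ₀ hβ₁
    refine tendsto_of_tendsto_of_tendsto_of_le_of_le' tendsto_const_nhds
      (tendsto_exp_neg_mul (by linarith : 0 < 1 - β) K) ?_ ?_
    · filter_upwards [Filter.eventually_ge_atTop 0] with θ hθ
      exact Filter.le_limsup_of_frequently_le
        (Filter.Eventually.of_forall fun n => tvDist_nonneg _ _).frequently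
        (Filter.isBoundedUnder_of_eventually_le (hK θ hθ))
    · filter_upwards [Filter.eventually_ge_atTop 0] with θ hθ
      exact Filter.limsup_le_of_le
        (Filter.isBoundedUnder_of_eventually_ge (Filter.Eventually.of_forall fun n =>
          tvDist_nonneg _ _)).isCoboundedUnder_le (hK θ hθ)

/-- The distances agree for n ≥ 1, and both limits ignore n = 0. -/
theorem glauber_exhibitsCutoff {β : ℝ} (hβ₀ : 0 ≤ β) (hβ₁ : β < 1) :
    ExhibitsCutoff (fun n => glauber n β) allPlus (fun n => gibbs n β)
      (cutoffTime β) (fun n => (n : ℤ)) := by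
  have h := magChain_exhibitsCutoff hβ₀ hβ₁
  have e : ∀ T : ℕ → ℕ, (fun n => tvDist (evolve (glauber n β) (allPlus n) (T n)) (gibbs n β))
      =ᶠ[Filter.atTop]
      fun n => tvDist (evolve (magChain n β) (magTop n) (T n)) (magLaw (gibbs n β)) := fun T => by
    filter_upwards [Filter.eventually_ge_atTop 1] with n hn
    rw [tvDist_glauber_eq hn β (fun _ _ h => allPlus_congr h), magLaw_allPlus]
  refine ⟨h.window, ?_, ?_⟩
  · exact h.before.congr fun θ => (Filter.liminf_congr (e _)).symm
  · exact h.after.congr fun θ => (Filter.limsup_congr (e _)).symm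

end MeanFieldIsing

end

theorem mainTheorem6 (β : ℝ) (hβ₀ : 0 ≤ β) (hβ₁ : β < 1) :
    -- both chains are Markov chains, each with its unique stationary distribution
    (∀ n : ℕ, 1 ≤ n →
      MeanFieldIsing.glauber n β ∈ Matrix.rowStochastic ℝ (MeanFieldIsing.Config n) ∧
      MeanFieldIsing.magChain n β ∈ Matrix.rowStochastic ℝ (Fin (n + 1)) ∧
      MeanFieldIsing.IsUniqueStationary (MeanFieldIsing.glauber n β) (MeanFieldIsing.gibbs n β) ∧
      MeanFieldIsing.IsUniqueStationary (MeanFieldIsing.magChain n β)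
        (MeanFieldIsing.magLaw (MeanFieldIsing.gibbs n β))) ∧
    -- the magnetization chain is the projection of the Glauber chain
    (∀ n : ℕ, 1 ≤ n → ∀ (σ : MeanFieldIsing.Config n) (j : Fin (n + 1)),
      MeanFieldIsing.magLaw (fun τ => MeanFieldIsing.glauber n β σ τ) j =
        MeanFieldIsing.magChain n β (MeanFieldIsing.magIndex σ) j) ∧
    -- both chains are at the same distance from stationarity
    (∀ n : ℕ, 1 ≤ n → ∀ l ∈ stdSimplex ℝ (MeanFieldIsing.Config n),
      (∀ σ τ : MeanFieldIsing.Config n,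
        MeanFieldIsing.magnetization σ = MeanFieldIsing.magnetization τ → l σ = l τ) →
      ∀ t : ℕ,
        MeanFieldIsing.tvDist (MeanFieldIsing.evolve (MeanFieldIsing.glauber n β) l t)
            (MeanFieldIsing.gibbs n β) =
          MeanFieldIsing.tvDist
            (MeanFieldIsing.evolve (MeanFieldIsing.magChain n β) (MeanFieldIsing.magLaw l) t)
            (MeanFieldIsing.magLaw (MeanFieldIsing.gibbs n β))) ∧
    -- cutoff of the Glauber dynamics started from all plus spins
    MeanFieldIsing.ExhibitsCutoff (fun n => MeanFieldIsing.glauber n β)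
      MeanFieldIsing.allPlus (fun n => MeanFieldIsing.gibbs n β)
      (MeanFieldIsing.cutoffTime β) (fun n => (n : ℤ)) ∧
    -- cutoff of the magnetization chain started from the maximal magnetization
    MeanFieldIsing.ExhibitsCutoff (fun n => MeanFieldIsing.magChain n β)
      MeanFieldIsing.magTop (fun n => MeanFieldIsing.magLaw (MeanFieldIsing.gibbs n β))
      (MeanFieldIsing.cutoffTime β) (fun n => (n : ℤ)) := by
  refine ⟨fun n hn => ⟨MeanFieldIsing.glauber_mem_rowStochastic hn β,
    MeanFieldIsing.magChain_mem_rowStochastic hn β, MeanFieldIsing.glauber_isUniqueStationary hn β,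
    MeanFieldIsing.magChain_isUniqueStationary hn hβ₀ hβ₁⟩,
    fun n hn σ j => MeanFieldIsing.magLaw_glauber hn β σ j,
    fun n hn l _ hl t => MeanFieldIsing.tvDist_glauber_eq hn β hl t,
    MeanFieldIsing.glauber_exhibitsCutoff hβ₀ hβ₁,
    MeanFieldIsing.magChain_exhibitsCutoff hβ₀ hβ₁⟩
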